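/- **Setting.** Let $i,j>0$ with $i+j=1$. Let $\theta\in\mathbb R$ be badly approximable with weight $i$: there is $c(\theta)>0$ with $q^{1/i}|q\theta-p|>c(\theta)$ for all $p\in\mathbb Z$, $q\in\mathbb N$; fix such a $c(\theta)$. Let $\Theta=\{\theta\}\times[0,1]$, and let $\mu$ be a Borel probability measure with $\operatorname{supp}\mu\subseteq\Theta$ which satisfies a power law: there are $\beta,b_1,b_2>0$ with $b_1r^\beta\le\mu(B(x,r))\le b_2r^\beta$ for all $x\in\operatorname{supp}\mu$, $0<r<1$. Put $\alpha=\frac{\beta ij}{4}$, $\lambda=\frac3j$, and for an integer $R\geq 1$ put $$c_1=\min\Big\{c(\theta)R^{1+\alpha},\tfrac14R^{-3i/j}\Big\},\qquad c=\frac{c_1}{R^{1+\alpha}}.$$ For integers $A,B,C$ with $\gcd(A,B,C)=1$ and $B>0$, let $L=L(A,B,C)$ be the line $Ax-By+C=0$, let $H(A,B)=B\max\{|A|^{1/i},|B|^{1/j}\}$ and $$\Delta(L)=\Theta\cap\Big\{(x,y):|Ax-By+C|\le\frac{c}{\max\{|A|^{1/i},|B|^{1/j}\}}\Big\}.$$ For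 $n,\ell\ge0$ let $C(n)$ be the set of those lines with $R^{n-1}\le H(A,B)<R^n$, and let $C(n,\ell)$ be the set of $L\in C(n)$ with $R^{-\lambda(\ell+1)}R^{\frac{nj}{j+1}}\le B<R^{-\lambda\ell}R^{\frac{nj}{j+1}}$. Identify points $(\theta,y)$ with $y$, and write $B(y,r)=[y-r,y+r]$, $\gamma B(y,r)=B(y,\gamma r)$, and $I^-=(1-R^{-\alpha})I$ for an interval $I$. Let $\mathcal I_0$ be a pairwise disjoint subcollection of $\tilde{\mathcal I}_0=\{B(y,\frac12c_1):(\theta,y)\in\operatorname{supp}\mu\}$ such that $\bigcup_{I\in\tilde{\mathcal I}_0}I\subseteq\bigcup_{I\in\mathcal I_0}5I$. Recursively, for every $I'\in\mathcal I_n$ let $\mathcal I_{n+1}(I')$ be a pairwise disjoint subcollection of $\tilde{\mathcal I}_{n+1}(I')=\{B(y,\frac12c_1R^{-n-1}):(\theta,y)\in\operatorname{supp}\mu,\ y\in I'^-\}$ such that $\bigcup_{I\in\tilde{\mathcal I}_{n+1}(I')}I\subseteq\bigcup_{I\in\mathcal I_{n+1}(I')}5I$, and let $\mathcal I_{n+1}=\bigcup_{I'\in\mathcal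 I_n}\mathcal I_{n+1}(I')$. Let $\mathcal J_0=\mathcal I_0$ and $$\mathcal J_{n+1}=\Big\{I\in\bigcup_{J\in\mathcal J_n}\mathcal I_{n+1}(J):\ \Delta(L)\cap I=\varnothing\ \text{ for all } L\in C(n)\Big\}.$$ **Theorem 8.** Let $$\varepsilon=\frac{\alpha\beta^2ij}{20},\qquad R\ge R_1=\max\left\{R_0,\Big(\frac{64b_2^2}{b_1^2}\Big)^{\frac{10}{\alpha\beta^2ij}},c_5^{\frac{2}{\alpha\beta}}\right\},\qquad c_5=4^{\frac2{ij}+2}\frac{b_2}{b_1},$$ where $R_0$ is the largest solution of $R_0^{\varepsilon}=\log_2R_0$. Then for all such choices of the collections, all integers $n,\ell\ge0$ with $\ell\le\frac{nj}{\lambda(j+1)}$ and every $J\in\mathcal J_{n-\ell}$, $$\#\{I\in\mathcal I_{n+1}:\ I\subseteq J,\ \exists L\in C(n,\ell)\ \ I\cap\Delta(L)\ne\varnothing\}\le R^{\beta-\varepsilon}.$$ -/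

import Mathlib

open Set MeasureTheory

noncomputable section

namespace VerticalCantor

/-! ### Constants -/

/-- `α = β i j / 4`. -/
def alpha (i j β : ℝ) : ℝ := β * i * j / 4

/-- `c₁ = min { c(θ) R^{1+α}, (1/4) R^{-3i/j} }`. -/
def cOne (i j β cθ : ℝ) (R : ℕ) : ℝ :=
  min (cθ * (R : ℝ) ^ (1 + alpha i j β)) (1 / 4 * (R : ℝ) ^ (-(3 * i / j)))

/-- `c = c₁ / R^{1+α}`. -/
def cRem (i j β cθ : ℝ) (R : ℕ) : ℝ :=
  cOne i j β cθ R / (R : ℝ) ^ (1 + alpha i j β)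

/-- `λ = 3 / j`. -/
def lam (j : ℝ) : ℝ := 3 / j

/-- `ε = α β² i j / 20`. -/
def eps (i j β : ℝ) : ℝ := alpha i j β * β ^ 2 * i * j / 20

/-- `c₅ = 4^{2/(ij)+2} b₂ / b₁`. -/
def cFive (i j b₁ b₂ : ℝ) : ℝ := (4 : ℝ) ^ (2 / (i * j) + 2) * (b₂ / b₁)

/-- `R₀` is the largest solution of `x^ε = log₂ x`. (For small `ε > 0` there are exactly two
solutions, and `x^ε ≥ log₂ x` for all `x` beyond the larger one.) -/
def RZero (ε : ℝ) : ℝ := sSup {x : ℝ | 0 < x ∧ x ^ ε = Real.logb 2 x}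

/-- `R₁ = max { R₀, (64 b₂² / b₁²)^{10/(α β² i j)}, c₅^{2/(α β)} }`. -/
def ROne (i j β b₁ b₂ : ℝ) : ℝ :=
  max (RZero (eps i j β))
    (max ((64 * b₂ ^ 2 / b₁ ^ 2) ^ (10 / (alpha i j β * β ^ 2 * i * j)))
      (cFive i j b₁ b₂ ^ (2 / (alpha i j β * β))))

/-! ### The vertical segment, power laws, badly approximable numbers -/

/-- `Θ = {(θ, y) : y ∈ [0,1]}`. -/
def Theta (θ : ℝ) : Set (ℝ × ℝ) := {p | p.1 = θ ∧ p.2 ∈ Icc (0 : ℝ) 1}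

/-- `μ` satisfies a power law with exponent `β` and constants `b₁, b₂`: for all `x` in the support
of `μ` and all `0 < r < 1`, `b₁ r^β ≤ μ(B(x,r)) ≤ b₂ r^β`. -/
def PowerLaw {X : Type*} [PseudoMetricSpace X] [MeasurableSpace X] (μ : Measure X)
    (β b₁ b₂ : ℝ) : Prop :=
  0 < β ∧ 0 < b₁ ∧ 0 < b₂ ∧
    ∀ x ∈ μ.support, ∀ r : ℝ, 0 < r → r < 1 →
      ENNReal.ofReal (b₁ * r ^ β) ≤ μ (Metric.closedBall x r) ∧
        μ (Metric.closedBall x r) ≤ ENNReal.ofReal (b₂ * r ^ β)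

/-- `cθ` is a positive constant witnessing that `θ` is badly approximable with weight `i`:
`q^{1/i} |qθ - p| > cθ` for all integers `p` and all positive integers `q`. -/
def BadConst (i θ cθ : ℝ) : Prop :=
  0 < cθ ∧ ∀ (p : ℤ) (q : ℕ), 0 < q → cθ < (q : ℝ) ^ (1 / i) * |(q : ℝ) * θ - (p : ℝ)|

/-! ### Closed intervals `B(y, r)` -/

/-- The closed interval `B(y, r)`, recorded by its centre and radius. -/
@[ext] structure CInterval where
  /-- the centre -/
  center : ℝ
  /-- the radius -/
  radius : ℝ

/-- The set of points `{x : |x - y| ≤ r}` of the interval `B(y, r)`. -/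
def CInterval.pts (I : CInterval) : Set ℝ := Metric.closedBall I.center I.radius

/-- `γ B(y, r) = B(y, γ r)`. -/
def CInterval.scale (γ : ℝ) (I : CInterval) : CInterval := ⟨I.center, γ * I.radius⟩

/-- `S` is a disjoint subcollection of `T` as provided by the `5r`-covering lemma. -/
def FiveRCover (T S : Set CInterval) : Prop :=
  S ⊆ T ∧ (∀ I ∈ S, ∀ I' ∈ S, I ≠ I' → Disjoint I.pts I'.pts) ∧
    (⋃ I ∈ T, I.pts) ⊆ ⋃ I ∈ S, (I.scale 5).pts

/-! ### Lines -/

/-- The (non-vertical) rational line `L(A,B,C) : A x - B y + C = 0`, where `gcd(A,B,C) = 1` and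
`B > 0`; every non-vertical rational line is obtained exactly once. -/
@[ext] structure RLine where
  /-- the coefficient of `x` -/
  A : ℤ
  /-- minus the coefficient of `y` -/
  B : ℤ
  /-- the constant coefficient -/
  C : ℤ
  /-- the coefficients are coprime -/
  gcd_eq_one : Int.gcd A (Int.gcd B C) = 1
  /-- the line is not vertical, and its sign is normalized -/
  B_pos : 0 < B

/-- `max { |A|^{1/i}, |B|^{1/j} }`. -/
def RLine.maxAB (i j : ℝ) (L : RLine) : ℝ :=
  max (|(L.A : ℝ)| ^ (1 / i)) (|(L.B : ℝ)| ^ (1 / j))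

/-- The height `H(A,B) = B · max { |A|^{1/i}, |B|^{1/j} }`. -/
def RLine.height (i j : ℝ) (L : RLine) : ℝ := (L.B : ℝ) * L.maxAB i j

/-- `Δ(L) = Θ ∩ {(x,y) : |A x - B y + C| ≤ c / max { |A|^{1/i}, |B|^{1/j} }}`, as a set of
`y`-coordinates. -/
def Delta (i j θ c : ℝ) (L : RLine) : Set ℝ :=
  {y | (θ, y) ∈ Theta θ ∧ |(L.A : ℝ) * θ - (L.B : ℝ) * y + (L.C : ℝ)| ≤ c / L.maxAB i j}

/-- `C(n)`: the lines with `R^{n-1} ≤ H(A,B) < R^n`. -/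
def linesC (i j : ℝ) (R n : ℕ) : Set RLine :=
  {L | (R : ℝ) ^ ((n : ℝ) - 1) ≤ L.height i j ∧ L.height i j < (R : ℝ) ^ (n : ℝ)}

/-- `C(n,ℓ)`: the lines of `C(n)` with
`R^{-λ(ℓ+1)} R^{nj/(j+1)} ≤ B < R^{-λℓ} R^{nj/(j+1)}`. -/
def linesCl (i j : ℝ) (R n l : ℕ) : Set RLine :=
  {L | L ∈ linesC i j R n ∧
    (R : ℝ) ^ (-(lam j * ((l : ℝ) + 1))) * (R : ℝ) ^ ((n : ℝ) * j / (j + 1)) ≤ (L.B : ℝ) ∧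
    (L.B : ℝ) < (R : ℝ) ^ (-(lam j * (l : ℝ))) * (R : ℝ) ^ ((n : ℝ) * j / (j + 1))}

/-! ### The construction -/

/-- `½ c₁ R^{-n}`, the radius of the intervals of level `n`. -/
def levelRadius (i j β cθ : ℝ) (R n : ℕ) : ℝ :=
  1 / 2 * cOne i j β cθ R * (R : ℝ) ^ (-(n : ℝ))

/-- All the intervals `B(y, ½ c₁)` with `(θ, y)` in the support of `μ`. -/
def rootCandidates (i j β θ cθ : ℝ) (R : ℕ) (μ : Measure (ℝ × ℝ)) : Set CInterval :=
  {I | (θ, I.center) ∈ μ.support ∧ I.radius = levelRadius i j β cθ R 0}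

/-- `I⁻ = (1 - R^{-α}) I`. -/
def shrink (i j β : ℝ) (R : ℕ) (I : CInterval) : CInterval :=
  I.scale (1 - (R : ℝ) ^ (-alpha i j β))

/-- For an interval `I'` of level `n`: all the intervals `B(y, ½ c₁ R^{-n-1})` with `(θ, y)` in the
support of `μ` and `y ∈ I'⁻`. -/
def childCandidates (i j β θ cθ : ℝ) (R : ℕ) (μ : Measure (ℝ × ℝ)) (n : ℕ) (I' : CInterval) :
    Set CInterval :=
  {I | (θ, I.center) ∈ μ.support ∧ I.center ∈ (shrink i j β R I').pts ∧
    I.radius = levelRadius i j β cθ R (n + 1)}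

/-- The collections `𝓘ₙ`, for given choices of the zeroth collection and of the
collection `child n I'` of subintervals of level `n + 1` of each interval `I'` of level `n`. -/
def colI (root : Set CInterval) (child : ℕ → CInterval → Set CInterval) : ℕ → Set CInterval
  | 0 => root
  | n + 1 => ⋃ I' ∈ colI root child n, child n I'

/-- The collections `𝓙ₙ`: `𝓙₀ = 𝓘₀`, and `𝓙ₙ₊₁` consists of the chosen subintervals of the
intervals of `𝓙ₙ` which do not meet `Δ(L)` for any `L ∈ C(n)`. -/
def colJ (i j β θ cθ : ℝ) (R : ℕ) (root : Set CInterval)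
    (child : ℕ → CInterval → Set CInterval) : ℕ → Set CInterval
  | 0 => root
  | n + 1 => {I | I ∈ (⋃ J ∈ colJ i j β θ cθ R root child n, child n J) ∧
      ∀ L ∈ linesC i j R n, Delta i j θ (cRem i j β cθ R) L ∩ I.pts = ∅}

/-- The choices of `𝓘₀` and of the subintervals of each interval in each `𝓘ₙ` are made
according to the `5r`-covering lemma. -/
def AdmissibleChoice (i j β θ cθ : ℝ) (R : ℕ) (μ : Measure (ℝ × ℝ)) (root : Set CInterval)
    (child : ℕ → CInterval → Set CInterval) : Prop :=
  FiveRCover (rootCandidates i j β θ cθ R μ) root ∧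
    ∀ n, ∀ I' ∈ colI root child n,
      FiveRCover (childCandidates i j β θ cθ R μ n I') (child n I')

/-- `{I ∈ 𝓘ₙ₊₁ : I ⊆ J and I ∩ Δ(L) ≠ ∅ for some L ∈ C(n,ℓ)}`. -/
def removed (i j β θ cθ : ℝ) (R : ℕ) (root : Set CInterval)
    (child : ℕ → CInterval → Set CInterval) (n l : ℕ) (J : CInterval) : Set CInterval :=
  {I | I ∈ colI root child (n + 1) ∧ I.pts ⊆ J.pts ∧
    ∃ L ∈ linesCl i j R n l, (I.pts ∩ Delta i j θ (cRem i j β cθ R) L).Nonempty}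

end VerticalCantor

end

/-!
The trace of a line `L = L(A, B, C)` on the vertical segment is the point `y_L = (A θ + C) / B`, and
`Δ(L)` is the interval of half-width `c / H(L)` around it. The point is that the traces of the lines of
`C(n, l)` whose `Δ` meet `J` cannot be crowded, because a crowd of lines would betray a line of small
height, and `J` avoids `Δ(L₀)` for all lines `L₀` with `H(L₀) < R ^ (n - l - 1)`.

Two lines cross at a rational point `P = (p / q, r / q)` with `q = |A₁ B₂ - A₂ B₁|` and
`|q θ - p| = B₁ B₂ |y₁ - y₂|`. By the pigeonhole principle (`exists_small_solution`) some line `L₀`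
through `P` has `|A₀| ≤ q ^ i` and `B₀ ≤ q ^ j`, hence height at most `q ^ (1 + j)`. If `q` and
`|q θ - p|` are small enough, then `L₀` is not vertical, since `θ` is badly approximable, and
`Δ(L₀)` contains the points of `J` in question, which is a contradiction (`false_of_small_point`).

The lines are sorted into dyadic classes according to the height, `H ≈ η R ^ (n - 1)`, and to `B`.
* If `l ≥ 1`, then `B` is so small that the crossing point of any two lines of a class would satisfy
  those bounds. So all lines of a class have the same trace.
* If `l = 0`, then all lines of a class are concurrent, because the determinant of three of them is
  an integer of absolute value less than one. For concurrent lines both `q` and `|q θ - p|` are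
  proportional to the distance of the traces. So if one gap between traces were
  less than `1 / T` times another one, both would be smaller than their trivial bounds by the
  factor `T`, and for `T = R ^ (-α i j / 2) min (η R ^ α) R` this is again contradictory.

In either case the traces of a class are nearly uniformly spread (`spread_of_height`), and the
power law bounds the number of intervals near them (`PowerLaw.card_le_of_spread`) by
`(b₂ / b₁) ^ 2 (120 R ^ (1 - α i j / 2)) ^ β`, uniformly in the class: `T` times the ratio of the
half-width of `Δ(L)` to the radius of an interval is at most a multiple of `R ^ (1 - α i j / 2)`.
There are `O(λ log₂² R)` classes. As `R ≥ R₀`, one has `R ^ ε ≥ log₂ R`, and also `R ^ ε ≥ 1 / ε`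
(`bounds_of_RZero_le`), which absorbs `λ` and all absolute constants. Finally `β ≤ 1` because the measure
lives on a segment (`PowerLaw.exponent_le_one`), so that `α β i j / 2 ≥ 10 ε`.
-/

namespace VerticalCantor

/-! ### The largest solution of `x ^ ε = log₂ x` -/

theorem continuousOn_rpow_sub_logb (ε : ℝ) :
    ContinuousOn (fun x : ℝ => x ^ ε - Real.logb 2 x) (Ioi 0) := by
  intro x hx
  have hx0 : x ≠ 0 := ne_of_gt hx
  refine ContinuousAt.continuousWithinAt (ContinuousAt.sub ?_ ?_)
  · exact Real.continuousAt_rpow_const x ε (Or.inl hx0)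
  · unfold Real.logb
    exact (Real.continuousAt_log hx0).div_const _

theorem exists_logb_lt_rpow {ε : ℝ} (hε : 0 < ε) :
    ∃ X : ℝ, ∀ x ≥ X, Real.logb 2 x < x ^ ε := by
  have h := (isLittleO_log_rpow_atTop hε).def (c := Real.log 2 / 2)
    (by have := Real.log_pos one_lt_two; positivity)
  obtain ⟨X, hX⟩ := Filter.eventually_atTop.1 (h.and (Filter.eventually_gt_atTop 1))
  refine ⟨X, fun x hx => ?_⟩
  obtain ⟨h1, h2⟩ := hX x hx
  have h2' : (1 : ℝ) < x := h2
  have hl := Real.log_pos one_lt_two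
  have hp : 0 < x ^ ε := Real.rpow_pos_of_pos (by linarith) _
  rw [Real.norm_of_nonneg (Real.log_pos h2').le, Real.norm_of_nonneg hp.le] at h1
  unfold Real.logb
  rw [div_lt_iff₀ hl]
  nlinarith

/-- The set defining `RZero` is bounded, so its supremum is not a junk value. -/
theorem bddAbove_solutions {ε : ℝ} (hε : 0 < ε) :
    BddAbove {x : ℝ | 0 < x ∧ x ^ ε = Real.logb 2 x} := by
  obtain ⟨X, hX⟩ := exists_logb_lt_rpow hε
  refine ⟨X, fun x hx => ?_⟩
  by_contra! h
  exact (hX x h.le).ne hx.2.symm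

/-- Where `x ^ ε ≤ log₂ x`, a solution lies further to the right. -/
theorem exists_solution_ge {ε x : ℝ} (hε : 0 < ε) (hx : 0 < x) (h : x ^ ε ≤ Real.logb 2 x) :
    ∃ y, x ≤ y ∧ 0 < y ∧ y ^ ε = Real.logb 2 y := by
  obtain ⟨X, hX⟩ := exists_logb_lt_rpow hε
  have hle : x ≤ max x X := le_max_left _ _
  have hc : ContinuousOn (fun x : ℝ => x ^ ε - Real.logb 2 x) (Icc x (max x X)) :=
    (continuousOn_rpow_sub_logb ε).mono fun y hy => hx.trans_le hy.1
  have h0 : (0 : ℝ) ∈ Icc (x ^ ε - Real.logb 2 x)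
      ((max x X) ^ ε - Real.logb 2 (max x X)) :=
    ⟨by linarith, by linarith [hX _ (le_max_right x X)]⟩
  obtain ⟨y, hy, hy0⟩ := intermediate_value_Icc hle hc h0
  exact ⟨y, hy.1, hx.trans_le hy.1, by simpa [sub_eq_zero] using hy0⟩

/-- Beyond `RZero ε`, the power `R ^ ε` dominates not only `log₂ R` but also `1 / ε`: at
`x = (1 / ε) ^ (1 / ε)` one still has `x ^ ε ≤ log₂ x`. -/
theorem bounds_of_RZero_le {ε R : ℝ} (hε : 0 < ε) (hε' : ε ≤ 1 / 2) (hR : RZero ε ≤ R) :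
    1 < R ∧ 1 / ε ≤ R ^ ε ∧ Real.logb 2 R ≤ R ^ ε := by
  have hb := bddAbove_solutions hε
  have hinv : 2 ≤ 1 / ε := by rw [le_div_iff₀ hε]; linarith
  have hx0 : 0 < (1 / ε) ^ (1 / ε) := by positivity
  have hpow : ((1 / ε) ^ (1 / ε)) ^ ε = 1 / ε := by
    rw [← Real.rpow_mul (by positivity), one_div_mul_cancel hε.ne', Real.rpow_one]
  have hlog : 1 ≤ Real.logb 2 (1 / ε) := by
    rw [Real.le_logb_iff_rpow_le one_lt_two (by positivity)]
    simpa using hinv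
  obtain ⟨y, hy, hy0, hys⟩ := exists_solution_ge hε hx0 (by
    rw [hpow, Real.logb_rpow_eq_mul_logb_of_pos (by positivity)]
    nlinarith)
  have hyR : (1 / ε) ^ (1 / ε) ≤ R := hy.trans ((le_csSup hb ⟨hy0, hys⟩).trans hR)
  have h1 : 1 < (1 / ε) ^ (1 / ε) := Real.one_lt_rpow (by linarith) (by positivity)
  have hR1 : 1 < R := h1.trans_le hyR
  refine ⟨hR1, ?_, ?_⟩
  · calc 1 / ε = ((1 / ε) ^ (1 / ε)) ^ ε := hpow.symm
      _ ≤ R ^ ε := Real.rpow_le_rpow hx0.le hyR hε.le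
  · by_contra! hlt
    obtain ⟨z, hz, hz0, hzs⟩ := exists_solution_ge hε (zero_lt_one.trans hR1) hlt.le
    have : z ≤ R := (le_csSup hb ⟨hz0, hzs⟩).trans hR
    obtain rfl : z = R := le_antisymm this hz
    exact hlt.ne hzs

/-! ### Consequences of the power law -/

section PowerLaw

variable {θ β b₁ b₂ : ℝ} {μ : Measure (ℝ × ℝ)}

/-- Packing bound: disjoint balls of radius `s` centred in the support, all of them inside one
ball of radius `D + s` centred in the support. -/
theorem PowerLaw.card_le (hμ : PowerLaw μ β b₁ b₂) {ι : Type*} (F : Finset ι) (x : ι → ℝ)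
    {s D z : ℝ} (hs : 0 < s) (hD : 0 ≤ D) (hDs : D + s < 1)
    (hx : ∀ a ∈ F, (θ, x a) ∈ μ.support) (hz : (θ, z) ∈ μ.support)
    (hsep : ∀ a ∈ F, ∀ b ∈ F, a ≠ b → 2 * s < |x a - x b|)
    (hclose : ∀ a ∈ F, |x a - z| ≤ D) :
    (F.card : ℝ) ≤ b₂ / b₁ * ((D + s) / s) ^ β := by
  obtain ⟨hβ, hb₁, hb₂, hμ⟩ := hμ
  have hdisj : (F : Set ι).PairwiseDisjoint fun a => Metric.closedBall ((θ, x a) : ℝ × ℝ) s := by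
    intro a ha b hb hab
    apply Metric.closedBall_disjoint_closedBall
    have := hsep a ha b hb hab
    rw [Prod.dist_eq, Real.dist_eq, Real.dist_eq]
    exact lt_of_lt_of_le (by linarith) (le_max_right _ _)
  have hsub : (⋃ a ∈ F, Metric.closedBall ((θ, x a) : ℝ × ℝ) s) ⊆
      Metric.closedBall (θ, z) (D + s) := by
    refine iUnion₂_subset fun a ha => Metric.closedBall_subset_closedBall' ?_
    rw [Prod.dist_eq, Real.dist_eq, Real.dist_eq]
    have := hclose a ha
    simp only [sub_self, abs_zero]
    rw [max_eq_right (abs_nonneg _)]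
    linarith
  have key : (F.card : ENNReal) * ENNReal.ofReal (b₁ * s ^ β) ≤
      ENNReal.ofReal (b₂ * (D + s) ^ β) := by
    calc (F.card : ENNReal) * ENNReal.ofReal (b₁ * s ^ β)
        = ∑ _a ∈ F, ENNReal.ofReal (b₁ * s ^ β) := by simp
      _ ≤ ∑ a ∈ F, μ (Metric.closedBall (θ, x a) s) :=
          Finset.sum_le_sum fun a ha => (hμ _ (hx a ha) s hs (by linarith)).1
      _ = μ (⋃ a ∈ F, Metric.closedBall (θ, x a) s) :=
          (measure_biUnion_finset hdisj fun _ _ => measurableSet_closedBall).symm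
      _ ≤ μ (Metric.closedBall (θ, z) (D + s)) := measure_mono hsub
      _ ≤ _ := (hμ _ hz _ (by linarith) hDs).2
  rw [← ENNReal.ofReal_natCast, ← ENNReal.ofReal_mul (by positivity),
    ENNReal.ofReal_le_ofReal_iff (by positivity)] at key
  have hsβ : 0 < s ^ β := Real.rpow_pos_of_pos hs β
  rw [Real.div_rpow (by linarith) hs.le, div_mul_div_comm, le_div_iff₀ (by positivity)]
  exact key

theorem PowerLaw.one_le_div (hμ : PowerLaw μ β b₁ b₂) {z : ℝ × ℝ} (hz : z ∈ μ.support) :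
    1 ≤ b₂ / b₁ := by
  have h := hμ.card_le (θ := z.1) (Finset.univ : Finset Unit) (fun _ => z.2) (s := 1 / 2)
    (D := 0) (z := z.2) (by norm_num) le_rfl (by norm_num) (by simpa using hz) hz
    (by simp) (by simp)
  simpa using h

/-- The exponent of a power law on a segment is at most one: cover the segment by `N` balls of
radius `1 / N` and let `N` grow. -/
theorem PowerLaw.exponent_le_one [IsProbabilityMeasure μ] (hμΘ : μ.support ⊆ Theta θ)
    (hμ : PowerLaw μ β b₁ b₂) : β ≤ 1 := by
  obtain ⟨hβ, hb₁, hb₂, hμ⟩ := hμ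
  have key : ∀ N : ℕ, 2 ≤ N → (N : ℝ) ^ (β - 1) ≤ b₂ := by
    intro N hN
    have hN0 : (0 : ℝ) < N := by positivity
    have hN2 : (2 : ℝ) ≤ N := by exact_mod_cast hN
    set piece : ℕ → Set (ℝ × ℝ) := fun a =>
      {p | p ∈ μ.support ∧ (a : ℝ) / N ≤ p.2 ∧ p.2 ≤ ((a : ℝ) + 1) / N} with hpiece
    have hcov : μ.support ⊆ ⋃ a ∈ Finset.range N, piece a := by
      intro p hp
      obtain ⟨-, h0, h1⟩ := hμΘ hp
      simp only [mem_iUnion, Finset.mem_range]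
      rcases eq_or_lt_of_le h1 with h1 | h1
      · refine ⟨N - 1, by omega, hp, ?_, ?_⟩
        · rw [Nat.cast_sub (by omega), div_le_iff₀ hN0, h1]; push_cast; linarith
        · rw [Nat.cast_sub (by omega), le_div_iff₀ hN0, h1]; push_cast; linarith
      · have hnn : 0 ≤ p.2 * N := by positivity
        refine ⟨⌊p.2 * N⌋₊, ?_, hp, ?_, ?_⟩
        · rw [Nat.floor_lt hnn]; nlinarith
        · rw [div_le_iff₀ hN0]; exact Nat.floor_le hnn
        · rw [le_div_iff₀ hN0]; exact (Nat.lt_floor_add_one _).le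
    have hone : (1 : ℝ) / N < 1 := by rw [div_lt_one hN0]; linarith
    have hp : ∀ a ∈ Finset.range N, μ (piece a) ≤ ENNReal.ofReal (b₂ * (1 / (N : ℝ)) ^ β) := by
      intro a _
      rcases (piece a).eq_empty_or_nonempty with he | ⟨p, hp⟩
      · simp [he]
      · refine (measure_mono fun w hw => ?_).trans (hμ p hp.1 _ (by positivity) hone).2
        rw [Metric.mem_closedBall, Prod.dist_eq, Real.dist_eq, Real.dist_eq, (hμΘ hw.1).1,
          (hμΘ hp.1).1, sub_self, abs_zero]
        have e : ((a : ℝ) + 1) / N = a / N + 1 / N := by ring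
        have := hw.2; have := hp.2
        refine max_le (by positivity) (abs_le.2 ⟨by linarith, by linarith⟩)
    have h1 : (1 : ENNReal) ≤ ENNReal.ofReal (N * (b₂ * (1 / (N : ℝ)) ^ β)) := by
      calc (1 : ENNReal) = μ univ := measure_univ.symm
        _ ≤ μ μ.support + μ μ.supportᶜ := by
            rw [← union_compl_self μ.support]; exact measure_union_le _ _
        _ = μ μ.support := by rw [Measure.measure_compl_support, add_zero]
        _ ≤ μ (⋃ a ∈ Finset.range N, piece a) := measure_mono hcov
        _ ≤ ∑ a ∈ Finset.range N, μ (piece a) := measure_biUnion_finset_le _ _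
        _ ≤ ∑ _a ∈ Finset.range N, ENNReal.ofReal (b₂ * (1 / (N : ℝ)) ^ β) :=
            Finset.sum_le_sum hp
        _ = _ := by
            rw [ENNReal.ofReal_mul hN0.le]; simp
    rw [ENNReal.one_le_ofReal] at h1
    rw [Real.rpow_sub hN0, Real.rpow_one]
    rw [Real.div_rpow zero_le_one hN0.le, Real.one_rpow] at h1
    have hNβ : 0 < (N : ℝ) ^ β := by positivity
    rw [div_le_iff₀ hN0]
    have : (N : ℝ) * (b₂ * (1 / (N : ℝ) ^ β)) = b₂ * N / (N : ℝ) ^ β := by ring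
    rw [this, le_div_iff₀ hNβ] at h1
    linarith
  by_contra! h
  have ht := (tendsto_rpow_atTop (sub_pos.2 h)).comp tendsto_natCast_atTop_atTop
  obtain ⟨N, hN⟩ := ((ht.eventually_gt_atTop b₂).and (Filter.eventually_ge_atTop 2)).exists
  exact absurd (key N hN.2) (not_le.2 hN.1)

/-- Counting points of the support near a set of reals which is nearly uniformly spread. Points
`x a` of the support are `2 r`-separated and `ρ`-close to marks `y a`, and any two distinct
marks are at least `1 / T` times as far apart as any other two. If all marks lie within `4 ρ T` of
each other, the points are packed into one interval; otherwise the marks are packed first, and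
then the points close to each mark. -/
theorem PowerLaw.card_le_of_spread (hμ : PowerLaw μ β b₁ b₂) {ι : Type*}
    (F : Finset ι) (x y : ι → ℝ) {r ρ T W : ℝ} (hr : 0 < r) (hrρ : r ≤ ρ) (hT : 1 ≤ T)
    (hsmall : 2 * W + 4 * ρ < 1)
    (hx : ∀ a ∈ F, (θ, x a) ∈ μ.support)
    (hsep : ∀ a ∈ F, ∀ b ∈ F, a ≠ b → 2 * r < |x a - x b|)
    (hxy : ∀ a ∈ F, |x a - y a| ≤ ρ)
    (hW : ∀ a ∈ F, ∀ b ∈ F, |y a - y b| ≤ W)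
    (hspread : ∀ a ∈ F, ∀ b ∈ F, y a ≠ y b → ∀ a' ∈ F, ∀ b' ∈ F,
      |y a' - y b'| ≤ T * |y a - y b|) :
    (F.card : ℝ) ≤ (b₂ / b₁) ^ 2 * (24 * (T * (ρ / r))) ^ β := by
  classical
  obtain ⟨hβ, hb₁, hb₂, -⟩ := id hμ
  have hρ : 0 < ρ := hr.trans_le hrρ
  rcases F.eq_empty_or_nonempty with rfl | hne
  · simp only [Finset.card_empty, Nat.cast_zero]; positivity
  have : Nonempty ι := ⟨hne.choose⟩
  have hK1 : 1 ≤ b₂ / b₁ := by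
    obtain ⟨a, ha⟩ := hne
    exact hμ.one_le_div (hx a ha)
  have hρr : 1 ≤ ρ / r := by rwa [_root_.one_le_div hr]
  obtain ⟨⟨a₁, a₂⟩, ha, hmax⟩ :=
    (F ×ˢ F).exists_max_image (fun p => |y p.1 - y p.2|) (hne.product hne)
  rw [Finset.mem_product] at ha
  obtain ⟨ha₁, ha₂⟩ := ha
  simp only at ha₁ ha₂ hmax
  set w := |y a₁ - y a₂| with hw
  have hmax' : ∀ a ∈ F, ∀ b ∈ F, |y a - y b| ≤ w := fun a ha b hb =>
    hmax (a, b) (Finset.mem_product.2 ⟨ha, hb⟩)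
  have hw0 : 0 ≤ w := abs_nonneg _
  have hwW : w ≤ W := hW _ ha₁ _ ha₂
  have hxclose : ∀ a ∈ F, ∀ b ∈ F, |x a - x b| ≤ |y a - y b| + 2 * ρ := by
    intro a ha b hb
    have h1 := abs_le.1 (hxy a ha)
    have h2 := abs_le.1 (hxy b hb)
    have h3 := le_abs_self (y a - y b)
    have h4 := neg_abs_le (y a - y b)
    exact abs_le.2 ⟨by linarith, by linarith⟩
  have hsq : ∀ {u : ℝ}, 0 ≤ u → u ≤ 24 * (T * (ρ / r)) →
      b₂ / b₁ * u ^ β ≤ (b₂ / b₁) ^ 2 * (24 * (T * (ρ / r))) ^ β := by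
    intro u hu huv
    have h1 : u ^ β ≤ (24 * (T * (ρ / r))) ^ β := Real.rpow_le_rpow hu huv hβ.le
    have h2 : b₂ / b₁ ≤ (b₂ / b₁) ^ 2 := by nlinarith
    have h3 : 0 ≤ u ^ β := Real.rpow_nonneg hu _
    exact mul_le_mul h2 h1 h3 (by positivity)
  by_cases hcase : w ≤ 4 * ρ * T
  · have h := hμ.card_le F x (s := r) (D := w + 2 * ρ) (z := x a₁) hr (by linarith)
      (by linarith) hx (hx _ ha₁) hsep
      (fun a ha => (hxclose a ha a₁ ha₁).trans (by linarith [hmax' a ha a₁ ha₁]))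
    refine h.trans (hsq (by positivity) ?_)
    rw [div_le_iff₀ hr]
    have : 24 * (T * (ρ / r)) * r = 24 * (T * ρ) := by field_simp
    rw [this]
    nlinarith
  · push Not at hcase
    have hT0 : 0 < T := by linarith
    have hwT : ∀ a ∈ F, ∀ b ∈ F, y a ≠ y b → w / T ≤ |y a - y b| := by
      intro a ha b hb hab
      rw [div_le_iff₀ hT0, mul_comm]
      exact hspread a ha b hb hab _ ha₁ _ ha₂
    have hσ : 4 * ρ < w / T := by rw [lt_div_iff₀ hT0]; exact hcase
    have hwT' : w / T ≤ w := div_le_self hw0 hT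
    have hρw : 4 * ρ < w := hσ.trans_le hwT'
    have himg : ∀ v ∈ F.image y, ∃ a ∈ F, y a = v := fun v hv => Finset.mem_image.1 hv
    choose! f hfF hfy using himg
    have hV : ((F.image y).card : ℝ) ≤ b₂ / b₁ * (8 * T) ^ β := by
      have h := hμ.card_le (F.image y) (fun v => x (f v)) (s := w / T / 4) (D := w + 2 * ρ)
        (z := x a₁) (by linarith) (by linarith) (by linarith)
        (fun v hv => hx _ (hfF v hv)) (hx _ ha₁) ?_
        (fun v hv => (hxclose _ (hfF v hv) a₁ ha₁).trans
          (by linarith [hmax' _ (hfF v hv) a₁ ha₁]))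
      · refine h.trans ?_
        gcongr
        rw [div_le_iff₀ (by linarith)]
        have : 8 * T * (w / T / 4) = 2 * w := by field_simp; ring
        rw [this]; linarith
      · intro v hv v' hv' hvv
        have hne : y (f v) ≠ y (f v') := by rwa [hfy v hv, hfy v' hv']
        have h1 := hwT _ (hfF v hv) _ (hfF v' hv') hne
        have h2 := abs_le.1 (hxy _ (hfF v hv))
        have h3 := abs_le.1 (hxy _ (hfF v' hv'))
        rcases abs_cases (y (f v) - y (f v')) with ⟨h4, -⟩ | ⟨h4, -⟩
        · exact lt_of_lt_of_le (by linarith) (le_abs_self _)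
        · exact lt_of_lt_of_le (by linarith) (neg_le_abs _)
    have hfib : ∀ v ∈ F.image y,
        (({a ∈ F | y a = v} : Finset ι).card : ℝ) ≤ b₂ / b₁ * (3 * (ρ / r)) ^ β := by
      intro v hv
      have h := hμ.card_le ({a ∈ F | y a = v} : Finset ι) x (s := r) (D := 2 * ρ) (z := x (f v))
        hr (by linarith) (by linarith) (fun a ha => hx a (Finset.mem_filter.1 ha).1)
        (hx _ (hfF v hv))
        (fun a ha b hb => hsep a (Finset.mem_filter.1 ha).1 b (Finset.mem_filter.1 hb).1)
        (fun a ha => by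
          have ha' := Finset.mem_filter.1 ha
          have h1 := hxclose a ha'.1 _ (hfF v hv)
          rw [ha'.2, hfy v hv, sub_self, abs_zero] at h1
          linarith)
      refine h.trans ?_
      gcongr
      rw [div_le_iff₀ hr]
      have : 3 * (ρ / r) * r = 3 * ρ := by field_simp
      rw [this]; linarith
    calc (F.card : ℝ) = ∑ v ∈ F.image y, (({a ∈ F | y a = v} : Finset ι).card : ℝ) := by
          rw [Finset.card_eq_sum_card_image y F]; push_cast; rfl
      _ ≤ ∑ _v ∈ F.image y, b₂ / b₁ * (3 * (ρ / r)) ^ β := Finset.sum_le_sum hfib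
      _ = (F.image y).card * (b₂ / b₁ * (3 * (ρ / r)) ^ β) := by simp
      _ ≤ b₂ / b₁ * (8 * T) ^ β * (b₂ / b₁ * (3 * (ρ / r)) ^ β) := by gcongr
      _ = (b₂ / b₁) ^ 2 * ((8 * T) ^ β * (3 * (ρ / r)) ^ β) := by ring
      _ = _ := by
          rw [← Real.mul_rpow (by positivity) (by positivity)]
          congr 2; ring

end PowerLaw

/-! ### Rational lines and their traces on the vertical segment -/

/-- The `y`-coordinate of the point of the line `L` above `θ`, that is, the centre of `Δ(L)`. -/
noncomputable def RLine.yAt (θ : ℝ) (L : RLine) : ℝ := ((L.A : ℝ) * θ + L.C) / L.B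

section Lines

variable {i j θ c : ℝ}

theorem RLine.one_le_B (L : RLine) : (1 : ℝ) ≤ L.B := by exact_mod_cast L.B_pos

theorem RLine.one_le_maxAB (i : ℝ) (hj : 0 < j) (L : RLine) : 1 ≤ L.maxAB i j := by
  refine le_max_of_le_right (Real.one_le_rpow ?_ (by positivity))
  exact L.one_le_B.trans (le_abs_self _)

theorem RLine.one_le_height (i : ℝ) (hj : 0 < j) (L : RLine) : 1 ≤ L.height i j :=
  one_le_mul_of_one_le_of_one_le L.one_le_B (L.one_le_maxAB i hj)

theorem RLine.eval_eq (θ y : ℝ) (L : RLine) :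
    (L.A : ℝ) * θ - L.B * y + L.C = L.B * (L.yAt θ - y) := by
  have := L.one_le_B
  have hB : (L.B : ℝ) ≠ 0 := by positivity
  unfold RLine.yAt
  field_simp
  ring

theorem RLine.C_eq (θ : ℝ) (L : RLine) : (L.C : ℝ) = L.B * L.yAt θ - L.A * θ := by
  have := L.eval_eq θ 0
  linarith

theorem abs_yAt_sub_le (hj : 0 < j) {L : RLine} {y : ℝ} (hy : y ∈ Delta i j θ c L) :
    |L.yAt θ - y| ≤ c / L.height i j := by
  have hB := L.one_le_B
  have hW := L.one_le_maxAB i hj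
  have h := hy.2
  rw [L.eval_eq, abs_mul, abs_of_pos (by linarith : (0 : ℝ) < L.B), le_div_iff₀ (by linarith)] at h
  unfold RLine.height
  rw [le_div_iff₀ (by positivity)]
  linarith

/-- Every integer vector with positive middle coordinate is a positive multiple of a line. -/
theorem exists_rline {A B C : ℤ} (hB : 0 < B) :
    ∃ (L : RLine) (g : ℤ), 0 < g ∧ A = g * L.A ∧ B = g * L.B ∧ C = g * L.C := by
  set g : ℕ := Int.gcd A (Int.gcd B C) with hg
  have hg0 : 0 < g := by
    refine Nat.pos_of_ne_zero fun h => ?_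
    have h1 := (Int.gcd_eq_zero_iff.1 (hg ▸ h)).2
    have h2 := (Int.gcd_eq_zero_iff.1 (Int.natCast_eq_zero.1 h1)).1
    omega
  have hdA : (g : ℤ) ∣ A := Int.gcd_dvd_left ..
  have hdBC : (g : ℤ) ∣ (Int.gcd B C : ℤ) := Int.gcd_dvd_right ..
  obtain ⟨a, ha⟩ := hdA
  obtain ⟨b, hb⟩ := hdBC.trans (Int.gcd_dvd_left ..)
  obtain ⟨d, hd⟩ := hdBC.trans (Int.gcd_dvd_right ..)
  have hgZ : (0 : ℤ) < g := by exact_mod_cast hg0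
  refine ⟨⟨a, b, d, ?_, ?_⟩, g, hgZ, ha, hb, hd⟩
  · have h1 : Int.gcd A (Int.gcd B C) = g * Int.gcd a (Int.gcd b d) := by
      rw [ha, hb, hd, Int.gcd_mul_left, Int.natAbs_natCast]
      push_cast
      rw [Int.gcd_mul_left, Int.natAbs_natCast]
    rw [← hg] at h1
    exact Nat.eq_of_mul_eq_mul_left hg0 (by rw [← h1, mul_one])
  · rw [hb] at hB
    exact (pos_iff_pos_of_mul_pos hB).1 hgZ

/-- Weighted pigeonhole: through every rational point `(p / q, r / q)` passes a line whose
coefficients are at most `q ^ i` and `q ^ j`. -/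
theorem exists_small_solution (hij : i + j = 1)
    {q : ℤ} (hq : 0 < q) (p r : ℤ) :
    ∃ A B C : ℤ, (A ≠ 0 ∨ B ≠ 0) ∧ 0 ≤ B ∧ |(A : ℝ)| ≤ (q : ℝ) ^ i ∧ (B : ℝ) ≤ (q : ℝ) ^ j ∧
      A * p - B * r + C * q = 0 := by
  have hq0 : (0 : ℝ) < q := by exact_mod_cast hq
  set a := ⌊(q : ℝ) ^ i⌋₊ with ha
  set b := ⌊(q : ℝ) ^ j⌋₊ with hb
  have hcard : (Finset.Ico (0 : ℤ) q).card <
      ((Finset.range (a + 1)) ×ˢ (Finset.range (b + 1))).card := by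
    rw [Int.card_Ico, Finset.card_product, Finset.card_range, Finset.card_range, sub_zero,
      Int.toNat_lt hq.le]
    have h : (q : ℝ) < ((a + 1 : ℕ) : ℝ) * ((b + 1 : ℕ) : ℝ) := by
      calc (q : ℝ) = (q : ℝ) ^ i * (q : ℝ) ^ j := by
            rw [← Real.rpow_add hq0, hij, Real.rpow_one]
        _ < _ := by
            push_cast
            exact mul_lt_mul'' (Nat.lt_floor_add_one _) (Nat.lt_floor_add_one _)
              (by positivity) (by positivity)
    exact_mod_cast h
  obtain ⟨⟨a₁, b₁⟩, h₁, ⟨a₂, b₂⟩, h₂, hne, heq⟩ :=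
    Finset.exists_ne_map_eq_of_card_lt_of_maps_to
      (f := fun z : ℕ × ℕ => ((z.1 : ℤ) * p - z.2 * r) % q) hcard (by
        intro z _
        exact Finset.mem_coe.2
          (Finset.mem_Ico.2 ⟨Int.emod_nonneg _ hq.ne', Int.emod_lt_of_pos _ hq⟩))
  wlog hb12 : b₂ ≤ b₁ generalizing a₁ b₁ a₂ b₂
  · exact this a₂ b₂ h₂ a₁ b₁ h₁ hne.symm heq.symm (by omega)
  simp only [Finset.mem_product, Finset.mem_range] at h₁ h₂
  obtain ⟨t, ht⟩ := Int.ModEq.dvd (show ((a₁ : ℤ) * p - b₁ * r) ≡ a₂ * p - b₂ * r [ZMOD q] from heq)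
  have hfa : (a : ℝ) ≤ (q : ℝ) ^ i := Nat.floor_le (by positivity)
  have hfb : (b : ℝ) ≤ (q : ℝ) ^ j := Nat.floor_le (by positivity)
  have e1 : (a₁ : ℝ) ≤ a := by exact_mod_cast Nat.lt_succ_iff.1 h₁.1
  have e2 : (a₂ : ℝ) ≤ a := by exact_mod_cast Nat.lt_succ_iff.1 h₂.1
  have e3 : (b₁ : ℝ) ≤ b := by exact_mod_cast Nat.lt_succ_iff.1 h₁.2
  have e4 : (0 : ℝ) ≤ a₁ := by positivity
  have e5 : (0 : ℝ) ≤ a₂ := by positivity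
  have e6 : (0 : ℝ) ≤ b₂ := by positivity
  refine ⟨a₁ - a₂, b₁ - b₂, t, ?_, by omega, ?_, ?_, by linear_combination -ht⟩
  · by_contra! h
    exact hne (Prod.ext (by have := h.1; simp only; omega) (by have := h.2; simp only; omega))
  · push_cast
    exact abs_le.2 ⟨by linarith, by linarith⟩
  · push_cast
    linarith

/-- Transference. Let `S` avoid `Δ(L₀)` for all lines `L₀` of height less than `H`. Then no line
of height at least `H` whose `Δ` meets `S` passes through a rational point `(p / q, r / q)` that is
close to the vertical line above `θ` and has a small denominator: by the pigeonhole principle some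
line `L₀` through that point has height less than `H / 4`, and `Δ(L₀)` contains the given
point `y`. That `L₀` is not vertical follows from `θ` being badly approximable. -/
theorem false_of_small_point (hi : 0 < i) (hj : 0 < j) (hij : i + j = 1) {cθ : ℝ}
    (hθ : BadConst i θ cθ) (hc0 : 0 < c) (hcθ : c ≤ cθ) {S : Set ℝ} {H : ℝ}
    (havoid : ∀ L : RLine, L.height i j < H → ∀ y ∈ S, y ∉ Delta i j θ c L)
    {p q r : ℤ} (hq : 0 < q) {L : RLine} {y : ℝ} (hyS : y ∈ S) (hyL : y ∈ Delta i j θ c L)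
    (hinc : L.A * p - L.B * r + L.C * q = 0) (hH : H ≤ L.height i j)
    (ha : 4 * (q : ℝ) ^ (1 + j) < H) (hb : (q : ℝ) ^ i * |(q : ℝ) * θ - p| ≤ c / 2)
    (hc : |(L.A : ℝ)| / L.B * (q : ℝ) ^ j * |(q : ℝ) * θ - p| ≤ c / 4) : False := by
  have hq0 : (0 : ℝ) < q := by exact_mod_cast hq
  obtain ⟨A, B, C, hne, hB, hAq, hBq, hABC⟩ := exists_small_solution hij hq p r
  set D := |(q : ℝ) * θ - p| with hD
  have hD0 : 0 ≤ D := abs_nonneg _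
  have hpow : ∀ {x s : ℝ}, 0 ≤ x → 0 < s → x ≤ (q : ℝ) ^ s → x ^ (1 / s) ≤ q := by
    intro x s hx hs h
    calc x ^ (1 / s) ≤ ((q : ℝ) ^ s) ^ (1 / s) := Real.rpow_le_rpow hx h (by positivity)
      _ = q := by rw [← Real.rpow_mul hq0.le, mul_one_div_cancel hs.ne', Real.rpow_one]
  have hABC' : (A : ℝ) * p - B * r + C * q = 0 := by exact_mod_cast hABC
  rcases hB.eq_or_lt with rfl | hB
  · have hA : A ≠ 0 := by simpa using hne
    have hbad : ∃ p' : ℤ, |((A.natAbs : ℕ) : ℝ) * θ - p'| = |(A : ℝ) * θ + C| := by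
      rw [Nat.cast_natAbs, Int.cast_abs]
      rcases abs_cases (A : ℝ) with ⟨h, -⟩ | ⟨h, -⟩
      · exact ⟨-C, by rw [h]; push_cast; congr 1; ring⟩
      · refine ⟨C, by rw [h, ← abs_neg]; congr 1; ring⟩
    obtain ⟨p', hp'⟩ := hbad
    have h1 := hθ.2 p' A.natAbs (Int.natAbs_pos.2 hA)
    rw [hp', Nat.cast_natAbs, Int.cast_abs] at h1
    have h2 : (q : ℝ) * |(A : ℝ) * θ + C| = |(A : ℝ)| * D := by
      rw [hD, ← abs_mul, ← abs_of_pos hq0, ← abs_mul, abs_of_pos hq0]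
      congr 1
      push_cast at hABC'
      linear_combination hABC'
    have h3 : |(A : ℝ)| ^ (1 / i) * |(A : ℝ) * θ + C| ≤ q * |(A : ℝ) * θ + C| :=
      mul_le_mul_of_nonneg_right (hpow (abs_nonneg _) hi hAq) (abs_nonneg _)
    have h4 : |(A : ℝ)| * D ≤ (q : ℝ) ^ i * D := mul_le_mul_of_nonneg_right hAq hD0
    linarith
  · obtain ⟨L₀, g, hg, rfl, rfl, rfl⟩ := exists_rline (A := A) (C := C) hB
    have hg1 : (1 : ℝ) ≤ g := by exact_mod_cast hg
    have hLB := L.one_le_B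
    have hLB₀ := L₀.one_le_B
    have hA₀ : |(L₀.A : ℝ)| ≤ (q : ℝ) ^ i := by
      refine le_trans ?_ hAq
      push_cast
      rw [abs_mul, abs_of_pos (by linarith : (0 : ℝ) < g)]
      exact le_mul_of_one_le_left (abs_nonneg _) hg1
    have hB₀ : (L₀.B : ℝ) ≤ (q : ℝ) ^ j := by
      refine le_trans ?_ hBq
      push_cast
      exact le_mul_of_one_le_left (by linarith) hg1
    have hW : L₀.maxAB i j ≤ q := by
      refine max_le (hpow (abs_nonneg _) hi hA₀) (hpow (abs_nonneg _) hj ?_)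
      rwa [abs_of_pos (by linarith : (0 : ℝ) < L₀.B)]
    have hW1 := L₀.one_le_maxAB i hj
    have hheight : L₀.height i j ≤ (q : ℝ) ^ (1 + j) := by
      unfold RLine.height
      rw [Real.rpow_add hq0, Real.rpow_one, mul_comm]
      exact mul_le_mul hW hB₀ (by linarith) hq0.le
    have hh0 : 0 < L₀.height i j := by linarith [L₀.one_le_height i hj]
    have hh : 0 < L.height i j := by linarith [L.one_le_height i hj]
    refine havoid L₀ (by linarith) y hyS ⟨hyL.1, ?_⟩
    rw [le_div_iff₀ (by linarith)]
    set d := (L.A : ℝ) * θ - L.B * y + L.C with hd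
    set d₀ := (L₀.A : ℝ) * θ - L₀.B * y + L₀.C with hd₀
    have hdle : |d| / L.B ≤ c / L.height i j := by
      have := abs_yAt_sub_le hj hyL
      rw [hd, L.eval_eq, abs_mul, abs_of_pos (by linarith : (0 : ℝ) < L.B)]
      rwa [mul_div_cancel_left₀ _ (by positivity)]
    have hinc' : (L.A : ℝ) * p - L.B * r + L.C * q = 0 := by exact_mod_cast hinc
    have hinc₀ : (L₀.A : ℝ) * p - L₀.B * r + L₀.C * q = 0 := by
      have h : (g : ℝ) * ((L₀.A : ℝ) * p - L₀.B * r + L₀.C * q) = 0 := by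
        push_cast at hABC'
        linear_combination hABC'
      exact (mul_eq_zero.1 h).resolve_left (by positivity)
    -- Both lines pass through `(p / q, r / q)`; this eliminates `r`.
    have hkey : (q : ℝ) * d₀ = L₀.A * (q * θ - p) - L₀.B * (L.A / L.B) * (q * θ - p)
        + q * (L₀.B * (d / L.B)) := by
      rw [hd, hd₀]
      field_simp
      linear_combination (L.B : ℝ) * hinc₀ - (L₀.B : ℝ) * hinc'
    have habs : (q : ℝ) * |d₀| ≤ |(L₀.A : ℝ)| * D + L₀.B * (|(L.A : ℝ)| / L.B) * D
        + q * (L₀.B * (|d| / L.B)) := by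
      have e : (q : ℝ) * |d₀| = |(q : ℝ) * d₀| := by rw [abs_mul, abs_of_pos hq0]
      have hBa : |(L.B : ℝ)| = L.B := abs_of_pos (by linarith)
      have hBa₀ : |(L₀.B : ℝ)| = L₀.B := abs_of_pos (by linarith)
      rw [e, hkey]
      refine (abs_add_le _ _).trans (add_le_add ((abs_sub _ _).trans (add_le_add ?_ ?_)) ?_)
      · rw [abs_mul]
      · rw [abs_mul, abs_mul, abs_div, hBa, hBa₀]
      · rw [abs_mul, abs_mul, abs_div, hBa, hBa₀, abs_of_pos hq0]
    have t1 : |(L₀.A : ℝ)| * D ≤ c / 2 := (mul_le_mul_of_nonneg_right hA₀ hD0).trans hb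
    have t2 : L₀.B * (|(L.A : ℝ)| / L.B) * D ≤ c / 4 := by
      refine le_trans ?_ hc
      rw [mul_comm (L₀.B : ℝ)]
      gcongr
    have t3 : L₀.maxAB i j * (L₀.B * (|d| / L.B)) ≤ c / 4 := by
      calc L₀.maxAB i j * (L₀.B * (|d| / L.B)) = L₀.height i j * (|d| / L.B) := by
            unfold RLine.height; ring
        _ ≤ L₀.height i j * (c / L.height i j) := by gcongr
        _ ≤ c / 4 := by
            rw [mul_div_assoc', div_le_iff₀ hh]
            nlinarith
    have h1 : L₀.maxAB i j * |d₀| ≤ c / 2 + c / 4 + L₀.maxAB i j * (L₀.B * (|d| / L.B)) := by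
      have h2 : (q : ℝ) * (|d₀| - L₀.B * (|d| / L.B)) ≤ c / 2 + c / 4 := by linarith
      have h3 : L₀.maxAB i j * (|d₀| - L₀.B * (|d| / L.B)) ≤ c / 2 + c / 4 := by
        rcases le_total 0 (|d₀| - L₀.B * (|d| / L.B)) with h | h
        · exact (mul_le_mul_of_nonneg_right hW h).trans h2
        · exact (mul_nonpos_of_nonneg_of_nonpos (by linarith) h).trans (by positivity)
      linarith
    linarith

end Lines

/-! ### Pairs of lines with comparable coefficients -/

section Pairs

variable {i j θ c : ℝ}

/-- The lines `L₁`, `L₂` cross at `(p / q, r / q)` with `q = A₁ B₂ - A₂ B₁` and `p = B₁ C₂ - B₂ C₁`; the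
distance of their traces above `θ` is `|q θ - p| / (B₁ B₂)`. -/
theorem cross_eq (θ : ℝ) (L₁ L₂ : RLine) :
    ((L₁.A * L₂.B - L₂.A * L₁.B : ℤ) : ℝ) * θ - ((L₁.B * L₂.C - L₂.B * L₁.C : ℤ) : ℝ) =
      L₁.B * L₂.B * (L₁.yAt θ - L₂.yAt θ) := by
  push_cast
  rw [L₁.C_eq θ, L₂.C_eq θ]
  ring

/-- Bounds under which a crossing point of two lines of large height is close enough to the
vertical line above `θ` for `false_of_small_point`. Here `X` and `B₀` bound the coefficients, and `T`
measures how much the denominator of the crossing point and its distance to the vertical line are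
below the trivial bounds. -/
theorem false_of_crossing (hi : 0 < i) (hj : 0 < j) (hij : i + j = 1) {cθ : ℝ}
    (hθ : BadConst i θ cθ) {R α c₁ N l u T X B₀ : ℝ} (hR : 1 < R) (hα : 0 < α) (hc₁ : 0 < c₁)
    (hc : c = c₁ / R ^ (1 + α)) (hcθ : c ≤ cθ) (hl : 0 ≤ l)
    {S : Set ℝ} (havoid : ∀ L : RLine, L.height i j < R ^ (N - l - 1) →
      ∀ y ∈ S, y ∉ Delta i j θ c L)
    (hu : 0 < u) (hT : 0 < T) (hB₀ : 0 < B₀) (hXB : X * B₀ ≤ 4 * u) (hB : B₀ ≤ 2 * u ^ j)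
    (hTi : 4096 * u ^ (1 + j) * R ^ (α + l - N + 1) ≤ T ^ (1 + i))
    (hTj : 4096 * u ^ (1 + j) * R ^ (α + l - N + 1) ≤ T ^ (1 + j))
    {L₁ L₂ : RLine} (hA₁ : |(L₁.A : ℝ)| ≤ X) (hB₁ : B₀ / 2 ≤ L₁.B)
    (hH₁ : R ^ (N - 1) ≤ L₁.height i j) {y : ℝ} (hyS : y ∈ S) (hyL : y ∈ Delta i j θ c L₁)
    (hq0 : L₁.A * L₂.B - L₂.A * L₁.B ≠ 0)
    (hq : |((L₁.A * L₂.B - L₂.A * L₁.B : ℤ) : ℝ)| ≤ 32 * u / T)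
    (hD : L₁.B * L₂.B * |L₁.yAt θ - L₂.yAt θ| ≤ 2 * c₁ * R ^ (l - N) * B₀ ^ 2 / T) :
    False := by
  have hR0 : 0 < R := by linarith
  have hc0 : 0 < c := by rw [hc]; positivity
  have hj1 : j ≤ 1 := by linarith
  have hX : 0 ≤ X := (abs_nonneg _).trans hA₁
  -- It does not matter which of the two orientations of the crossing point is used.
  suffices main : ∀ q p r : ℤ, 0 < q → (q : ℝ) ≤ 32 * u / T →
      |(q : ℝ) * θ - p| ≤ 2 * c₁ * R ^ (l - N) * B₀ ^ 2 / T →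
      L₁.A * p - L₁.B * r + L₁.C * q = 0 → False by
    have hDeq := cross_eq θ L₁ L₂
    have hBB : (0 : ℝ) ≤ L₁.B * L₂.B := mul_nonneg (by linarith [L₁.one_le_B])
      (by linarith [L₂.one_le_B])
    have hD' : |((L₁.A * L₂.B - L₂.A * L₁.B : ℤ) : ℝ) * θ -
        ((L₁.B * L₂.C - L₂.B * L₁.C : ℤ) : ℝ)| ≤ 2 * c₁ * R ^ (l - N) * B₀ ^ 2 / T := by
      rw [hDeq, abs_mul, abs_of_nonneg hBB]
      exact hD
    rcases lt_or_gt_of_ne hq0 with h | h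
    · refine main (-(L₁.A * L₂.B - L₂.A * L₁.B)) (-(L₁.B * L₂.C - L₂.B * L₁.C))
        (-(L₁.A * L₂.C - L₂.A * L₁.C)) (by omega) ?_ ?_ (by ring)
      · rw [Int.cast_neg]
        exact (neg_le_abs _).trans hq
      · rw [Int.cast_neg, Int.cast_neg, ← abs_neg]
        convert hD' using 2
        ring
    · exact main _ _ (L₁.A * L₂.C - L₂.A * L₁.C) h ((le_abs_self _).trans hq) hD' (by ring)
  intro q p r hq0 hq hD hinc
  have hqR : (0 : ℝ) < q := by exact_mod_cast hq0
  set e := R ^ (α + l - N + 1) with he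
  have he0 : 0 < e := by positivity
  set g := R ^ (l - N) with hg
  have hg0 : 0 < g := by positivity
  set V := u ^ (1 + j) with hV
  have hV0 : 0 < V := by positivity
  have hce : c * e = c₁ * g := by
    rw [hc, he, hg, div_mul_eq_mul_div, div_eq_iff (by positivity), mul_assoc,
      ← Real.rpow_add hR0]
    congr 2
    ring
  have hqs : ∀ s : ℝ, 0 ≤ s → s ≤ 1 → (q : ℝ) ^ s ≤ 32 * u ^ s / T ^ s := by
    intro s hs hs1
    calc (q : ℝ) ^ s ≤ (32 * u / T) ^ s := Real.rpow_le_rpow hqR.le hq hs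
      _ = 32 ^ s * u ^ s / T ^ s := by
          rw [Real.div_rpow (by positivity) hT.le, Real.mul_rpow (by norm_num) hu.le]
      _ ≤ 32 * u ^ s / T ^ s := by
          gcongr
          calc (32 : ℝ) ^ s ≤ 32 ^ (1 : ℝ) := Real.rpow_le_rpow_of_exponent_le (by norm_num) hs1
            _ = 32 := Real.rpow_one _
  refine false_of_small_point hi hj hij hθ hc0 hcθ havoid hq0 hyS hyL hinc
    (le_trans (Real.rpow_le_rpow_of_exponent_le hR.le (by linarith)) hH₁) ?_ ?_ ?_
  · have h1 : (q : ℝ) ^ (1 + j) ≤ 1024 * V / T ^ (1 + j) := by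
      rw [Real.rpow_add hqR, Real.rpow_one, hV, Real.rpow_add hu, Real.rpow_one,
        Real.rpow_add hT, Real.rpow_one]
      calc (q : ℝ) * (q : ℝ) ^ j ≤ 32 * u / T * (32 * u ^ j / T ^ j) := by
            gcongr
            exact hqs j hj.le hj1
        _ = _ := by field_simp; norm_num
    have h2 : 4 * (q : ℝ) ^ (1 + j) ≤ e⁻¹ := by
      refine (mul_le_mul_of_nonneg_left h1 (by norm_num)).trans ?_
      rw [mul_div_assoc', div_le_iff₀ (by positivity), inv_mul_eq_div, le_div_iff₀ he0]
      linarith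
    refine h2.trans_lt ?_
    rw [he, ← Real.rpow_neg hR0.le]
    exact Real.rpow_lt_rpow_of_exponent_lt hR (by linarith)
  · have hu1 : u ^ i * (u ^ j) ^ 2 = V := by
      rw [hV, ← Real.rpow_natCast, ← Real.rpow_mul hu.le, ← Real.rpow_add hu]
      congr 1
      push_cast
      linarith
    have hB2 : B₀ ^ 2 ≤ 4 * (u ^ j) ^ 2 := by
      calc B₀ ^ 2 ≤ (2 * u ^ j) ^ 2 := by gcongr
        _ = _ := by ring
    calc (q : ℝ) ^ i * |(q : ℝ) * θ - p|
        ≤ (32 * u ^ i / T ^ i) * (2 * c₁ * g * (4 * (u ^ j) ^ 2) / T) := by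
          refine mul_le_mul (hqs i hi.le (by linarith)) (hD.trans ?_) (abs_nonneg _)
            (by positivity)
          gcongr
      _ = 256 * (c₁ * g) * V / T ^ (1 + i) := by
          rw [← hu1, Real.rpow_add hT, Real.rpow_one]
          field_simp
          norm_num
      _ ≤ c / 2 := by
          rw [← hce, div_le_iff₀ (by positivity)]
          have := mul_le_mul_of_nonneg_left hTi hc0.le
          have h3 : 0 < c * e * V := by positivity
          nlinarith
  · have h1 : |(L₁.A : ℝ)| / L₁.B ≤ 2 * X / B₀ := by
      rw [div_le_div_iff₀ (by linarith [L₁.one_le_B]) hB₀]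
      have : |(L₁.A : ℝ)| * B₀ ≤ X * B₀ := mul_le_mul_of_nonneg_right hA₁ hB₀.le
      nlinarith
    calc |(L₁.A : ℝ)| / L₁.B * (q : ℝ) ^ j * |(q : ℝ) * θ - p|
        ≤ 2 * X / B₀ * (32 * u ^ j / T ^ j) * (2 * c₁ * g * B₀ ^ 2 / T) := by
          refine mul_le_mul (mul_le_mul h1 (hqs j hj.le hj1) (by positivity) (by positivity))
            hD (abs_nonneg _) (by positivity)
      _ = 128 * (c₁ * g) * ((X * B₀) * u ^ j) / T ^ (1 + j) := by
          rw [Real.rpow_add hT, Real.rpow_one]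
          field_simp
          ring
      _ ≤ 128 * (c₁ * g) * (4 * u * u ^ j) / T ^ (1 + j) := by gcongr
      _ = 512 * (c₁ * g) * V / T ^ (1 + j) := by
          rw [hV, Real.rpow_add hu, Real.rpow_one]
          ring
      _ ≤ c / 4 := by
          rw [← hce, div_le_iff₀ (by positivity)]
          have := mul_le_mul_of_nonneg_left hTj hc0.le
          have h3 : 0 < c * e * V := by positivity
          nlinarith

/-- Two lines which meet the vertical line above `θ` in distinct points that are close to each
other are not parallel. -/
theorem cross_ne_zero {L₁ L₂ : RLine} (hne : L₁.yAt θ ≠ L₂.yAt θ)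
    (h : L₁.B * L₂.B * |L₁.yAt θ - L₂.yAt θ| < 1) : L₁.A * L₂.B - L₂.A * L₁.B ≠ 0 := by
  intro h0
  have hc := cross_eq θ L₁ L₂
  have hB₁ := L₁.one_le_B
  have hB₂ := L₂.one_le_B
  have hBB : (0 : ℝ) < L₁.B * L₂.B := by positivity
  rw [h0, Int.cast_zero, zero_mul, zero_sub] at hc
  have h1 : |((L₁.B * L₂.C - L₂.B * L₁.C : ℤ) : ℝ)| < 1 := by
    rw [← abs_neg, hc, abs_mul, abs_of_pos hBB]
    exact h
  have h2 : L₁.B * L₂.C - L₂.B * L₁.C = 0 := by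
    rw [← Int.abs_lt_one_iff]
    exact_mod_cast h1
  rw [h2, Int.cast_zero, neg_zero] at hc
  exact hne (sub_eq_zero.1 ((mul_eq_zero.1 hc.symm).resolve_left hBB.ne'))

/-- Three lines whose traces above `θ` are close to each other are concurrent: the determinant of
their coefficients is an integer of absolute value less than one. -/
theorem concurrent_of_close {X B₀ g : ℝ} (L : Fin 3 → RLine)
    (hA : ∀ k, |((L k).A : ℝ)| ≤ X) (hB : ∀ k, ((L k).B : ℝ) ≤ B₀)
    (hg : ∀ k k', |(L k).yAt θ - (L k').yAt θ| ≤ g) (hsmall : 3 * (X * B₀ ^ 2 * g) < 1) :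
    (L 2).A * ((L 0).B * (L 1).C - (L 1).B * (L 0).C) -
      (L 2).B * ((L 0).A * (L 1).C - (L 1).A * (L 0).C) +
      (L 2).C * ((L 0).A * (L 1).B - (L 1).A * (L 0).B) = 0 := by
  have hX : 0 ≤ X := (abs_nonneg _).trans (hA 0)
  have hterm : ∀ k k' k'' m m', |((L k).A : ℝ) * (L k').B * (L k'').B *
      ((L m).yAt θ - (L m').yAt θ)| ≤ X * B₀ ^ 2 * g := by
    intro k k' k'' m m'
    have h1 := (L k').one_le_B
    have h2 := (L k'').one_le_B
    rw [abs_mul, abs_mul, abs_mul, abs_of_nonneg (by linarith : (0 : ℝ) ≤ (L k').B),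
      abs_of_nonneg (by linarith : (0 : ℝ) ≤ (L k'').B)]
    have h3 : |((L k).A : ℝ)| * (L k').B * (L k'').B ≤ X * B₀ * B₀ :=
      mul_le_mul (mul_le_mul (hA k) (hB k') (by linarith) hX) (hB k'') (by linarith)
        (mul_nonneg hX (by linarith [hB k']))
    calc _ ≤ X * B₀ * B₀ * g :=
          mul_le_mul h3 (hg m m') (abs_nonneg _)
            (mul_nonneg (mul_nonneg hX (by linarith [hB k'])) (by linarith [hB k']))
      _ = _ := by ring
  rw [← Int.abs_lt_one_iff]
  have key : |(((L 2).A * ((L 0).B * (L 1).C - (L 1).B * (L 0).C) -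
      (L 2).B * ((L 0).A * (L 1).C - (L 1).A * (L 0).C) +
      (L 2).C * ((L 0).A * (L 1).B - (L 1).A * (L 0).B) : ℤ) : ℝ)| < 1 := by
    have e : (((L 2).A * ((L 0).B * (L 1).C - (L 1).B * (L 0).C) -
        (L 2).B * ((L 0).A * (L 1).C - (L 1).A * (L 0).C) +
        (L 2).C * ((L 0).A * (L 1).B - (L 1).A * (L 0).B) : ℤ) : ℝ) =
        (L 2).A * (L 0).B * (L 1).B * ((L 1).yAt θ - (L 0).yAt θ) -
        (L 0).A * (L 1).B * (L 2).B * ((L 1).yAt θ - (L 2).yAt θ) +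
        (L 1).A * (L 0).B * (L 2).B * ((L 0).yAt θ - (L 2).yAt θ) := by
      push_cast
      rw [(L 0).C_eq θ, (L 1).C_eq θ, (L 2).C_eq θ]
      ring
    rw [e]
    refine (abs_add_le _ _).trans_lt ?_
    have := abs_sub ((L 2).A * (L 0).B * (L 1).B * ((L 1).yAt θ - (L 0).yAt θ))
      ((L 0).A * (L 1).B * (L 2).B * ((L 1).yAt θ - (L 2).yAt θ))
    linarith [hterm 2 0 1 1 0, hterm 0 1 2 1 2, hterm 1 0 2 0 2]
  exact_mod_cast key

theorem abs_cross_le {X B₀ : ℝ} {L₁ L₂ : RLine} (hA₁ : |(L₁.A : ℝ)| ≤ X) (hA₂ : |(L₂.A : ℝ)| ≤ X)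
    (hB₁ : (L₁.B : ℝ) ≤ B₀) (hB₂ : (L₂.B : ℝ) ≤ B₀) :
    |((L₁.A * L₂.B - L₂.A * L₁.B : ℤ) : ℝ)| ≤ 2 * (X * B₀) := by
  have hX : 0 ≤ X := (abs_nonneg _).trans hA₁
  have h1 := L₁.one_le_B
  have h2 := L₂.one_le_B
  push_cast
  refine (abs_sub _ _).trans ?_
  rw [abs_mul, abs_mul, abs_of_nonneg (by linarith : (0 : ℝ) ≤ L₁.B),
    abs_of_nonneg (by linarith : (0 : ℝ) ≤ L₂.B)]
  have h3 := mul_le_mul hA₁ hB₂ (by linarith) hX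
  have h4 := mul_le_mul hA₂ hB₁ (by linarith) hX
  linarith

/-- For concurrent lines, the differences of the slopes are proportional to the differences of
the traces above `θ`. -/
theorem cross_mul_eq {L₁ L₂ L₃ L₄ : RLine}
    (h₃ : L₃.A * (L₁.B * L₂.C - L₂.B * L₁.C) - L₃.B * (L₁.A * L₂.C - L₂.A * L₁.C) +
      L₃.C * (L₁.A * L₂.B - L₂.A * L₁.B) = 0)
    (h₄ : L₄.A * (L₁.B * L₂.C - L₂.B * L₁.C) - L₄.B * (L₁.A * L₂.C - L₂.A * L₁.C) +
      L₄.C * (L₁.A * L₂.B - L₂.A * L₁.B) = 0) :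
    ((L₁.A * L₂.B - L₂.A * L₁.B : ℤ) : ℝ) * (L₃.B * L₄.B * (L₃.yAt θ - L₄.yAt θ)) =
      ((L₃.A * L₄.B - L₄.A * L₃.B : ℤ) : ℝ) * (L₁.B * L₂.B * (L₁.yAt θ - L₂.yAt θ)) := by
  have h₃' : (L₃.A : ℝ) * (L₁.B * L₂.C - L₂.B * L₁.C) - L₃.B * (L₁.A * L₂.C - L₂.A * L₁.C) +
      L₃.C * (L₁.A * L₂.B - L₂.A * L₁.B) = 0 := by exact_mod_cast h₃
  have h₄' : (L₄.A : ℝ) * (L₁.B * L₂.C - L₂.B * L₁.C) - L₄.B * (L₁.A * L₂.C - L₂.A * L₁.C) +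
      L₄.C * (L₁.A * L₂.B - L₂.A * L₁.B) = 0 := by exact_mod_cast h₄
  rw [← cross_eq, ← cross_eq]
  push_cast
  linear_combination (L₄.B : ℝ) * h₃' - (L₃.B : ℝ) * h₄'

/-- The traces above `θ` of lines with comparable coefficients whose `Δ` meet `S` are nearly
uniformly spread: all gaps are comparable up to the factor `T`. A much smaller gap would
force a crossing point with small denominator very close to the vertical line. -/
theorem spread_of_comparable (hi : 0 < i) (hj : 0 < j) (hij : i + j = 1) {cθ : ℝ}
    (hθ : BadConst i θ cθ) {R α c₁ N l u T X B₀ : ℝ} (hR : 1 < R) (hα : 0 < α) (hc₁ : 0 < c₁)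
    (hc : c = c₁ / R ^ (1 + α)) (hcθ : c ≤ cθ) (hl : 0 ≤ l)
    {S : Set ℝ} (havoid : ∀ L : RLine, L.height i j < R ^ (N - l - 1) →
      ∀ y ∈ S, y ∉ Delta i j θ c L)
    (hu : 0 < u) (hT : 0 < T) (hB₀ : 0 < B₀) (hXB : X * B₀ ≤ 4 * u) (hB : B₀ ≤ 2 * u ^ j)
    (hTi : 4096 * u ^ (1 + j) * R ^ (α + l - N + 1) ≤ T ^ (1 + i))
    (hTj : 4096 * u ^ (1 + j) * R ^ (α + l - N + 1) ≤ T ^ (1 + j))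
    {𝓛 : Set RLine} (hA : ∀ L ∈ 𝓛, |(L.A : ℝ)| ≤ X)
    (hBl : ∀ L ∈ 𝓛, B₀ / 2 ≤ L.B) (hBu : ∀ L ∈ 𝓛, (L.B : ℝ) ≤ B₀)
    (hH : ∀ L ∈ 𝓛, R ^ (N - 1) ≤ L.height i j)
    (hS : ∀ L ∈ 𝓛, ∃ y ∈ S, y ∈ Delta i j θ c L)
    (hclose : ∀ L ∈ 𝓛, ∀ L' ∈ 𝓛, |L.yAt θ - L'.yAt θ| ≤ 2 * c₁ * R ^ (l - N))
    (hpar : ∀ L ∈ 𝓛, ∀ L' ∈ 𝓛, L.B * L'.B * |L.yAt θ - L'.yAt θ| < 1)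
    (hconc : T = 1 ∨ 3 * (X * B₀ ^ 2 * (2 * c₁ * R ^ (l - N))) < 1) :
    ∀ L₁ ∈ 𝓛, ∀ L₂ ∈ 𝓛, L₁.yAt θ ≠ L₂.yAt θ → ∀ L₃ ∈ 𝓛, ∀ L₄ ∈ 𝓛,
      |L₃.yAt θ - L₄.yAt θ| ≤ T * |L₁.yAt θ - L₂.yAt θ| := by
  intro L₁ h₁ L₂ h₂ hne L₃ h₃ L₄ h₄
  by_contra! hlt
  obtain ⟨y, hyS, hyL⟩ := hS L₁ h₁
  have hq0 := cross_ne_zero hne (hpar L₁ h₁ L₂ h₂)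
  have b₁ := L₁.one_le_B
  have b₂ := L₂.one_le_B
  have b₃ := L₃.one_le_B
  have b₄ := L₄.one_le_B
  have hX : 0 ≤ X := (abs_nonneg _).trans (hA L₁ h₁)
  have hBB : (L₁.B : ℝ) * L₂.B ≤ B₀ ^ 2 := by
    rw [sq]
    exact mul_le_mul (hBu _ h₁) (hBu _ h₂) (by linarith) hB₀.le
  have hd : 0 < |L₁.yAt θ - L₂.yAt θ| := abs_pos.2 (sub_ne_zero.2 hne)
  have hD : L₁.B * L₂.B * |L₁.yAt θ - L₂.yAt θ| ≤ 2 * c₁ * R ^ (l - N) * B₀ ^ 2 / T := by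
    rw [le_div_iff₀ hT]
    calc L₁.B * L₂.B * |L₁.yAt θ - L₂.yAt θ| * T
        = (L₁.B * L₂.B) * (T * |L₁.yAt θ - L₂.yAt θ|) := by ring
      _ ≤ B₀ ^ 2 * (2 * c₁ * R ^ (l - N)) :=
          mul_le_mul hBB (hlt.le.trans (hclose _ h₃ _ h₄)) (by positivity) (by positivity)
      _ = _ := by ring
  refine false_of_crossing hi hj hij hθ hR hα hc₁ hc hcθ hl havoid hu hT hB₀ hXB hB hTi hTj
    (hA _ h₁) (hBl _ h₁) (hH _ h₁) hyS hyL hq0 ?_ hD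
  rcases hconc with rfl | hconc
  · have := abs_cross_le (hA _ h₁) (hA _ h₂) (hBu _ h₁) (hBu _ h₂)
    linarith
  · have hinc : ∀ L ∈ 𝓛, L.A * (L₁.B * L₂.C - L₂.B * L₁.C) -
        L.B * (L₁.A * L₂.C - L₂.A * L₁.C) + L.C * (L₁.A * L₂.B - L₂.A * L₁.B) = 0 := by
      intro L h
      have hall : ∀ k, (![L₁, L₂, L] : Fin 3 → RLine) k ∈ 𝓛 := by
        intro k
        fin_cases k <;> simpa
      exact concurrent_of_close (θ := θ) ![L₁, L₂, L] (fun k => hA _ (hall k))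
        (fun k => hBu _ (hall k)) (fun k k' => hclose _ (hall k) _ (hall k')) hconc
    have hkey := congrArg abs (cross_mul_eq (θ := θ) (hinc L₃ h₃) (hinc L₄ h₄))
    have hb12 : (0 : ℝ) < L₁.B * L₂.B := by positivity
    have hb34 : (0 : ℝ) < L₃.B * L₄.B := by positivity
    rw [abs_mul, abs_mul _ (_ * _), abs_mul (_ * _), abs_mul (_ * _), abs_of_pos hb12,
      abs_of_pos hb34] at hkey
    set q₁₂ := |((L₁.A * L₂.B - L₂.A * L₁.B : ℤ) : ℝ)| with hq₁₂
    set q₃₄ := |((L₃.A * L₄.B - L₄.A * L₃.B : ℤ) : ℝ)| with hq₃₄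
    have h34 : q₃₄ ≤ 2 * (X * B₀) := abs_cross_le (hA _ h₃) (hA _ h₄) (hBu _ h₃) (hBu _ h₄)
    have hq12 : 0 < q₁₂ := abs_pos.2 (by exact_mod_cast hq0)
    have hquad : (L₁.B : ℝ) * L₂.B ≤ 4 * (L₃.B * L₄.B) := by
      have := mul_le_mul (hBl _ h₃) (hBl _ h₄) (by positivity) (by linarith)
      linarith
    rw [le_div_iff₀ hT]
    have s1 : q₁₂ * T * (L₃.B * L₄.B * |L₁.yAt θ - L₂.yAt θ|) ≤
        8 * (X * B₀) * (L₃.B * L₄.B * |L₁.yAt θ - L₂.yAt θ|) := by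
      calc q₁₂ * T * (L₃.B * L₄.B * |L₁.yAt θ - L₂.yAt θ|)
          = q₁₂ * (L₃.B * L₄.B * (T * |L₁.yAt θ - L₂.yAt θ|)) := by ring
        _ ≤ q₁₂ * (L₃.B * L₄.B * |L₃.yAt θ - L₄.yAt θ|) := by gcongr
        _ = q₃₄ * (L₁.B * L₂.B * |L₁.yAt θ - L₂.yAt θ|) := hkey
        _ ≤ 2 * (X * B₀) * (4 * (L₃.B * L₄.B) * |L₁.yAt θ - L₂.yAt θ|) := by gcongr
        _ = _ := by ring
    have s2 := le_of_mul_le_mul_right s1 (by positivity)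
    linarith

end Pairs

/-! ### The spreading factor -/

section Spread

variable {i j : ℝ}

/-- The spreading factor `T = R ^ (-δ) * min (η R ^ α) R` gains a power of `R` over `η R ^ α` when
raised to the power `1 + s`, provided `δ` is small compared with `α s`. -/
theorem mul_le_spread_rpow {R α δ η s : ℝ} (hR : 1 < R) (hα : 0 < α)
    (hη : 1 ≤ η) (hη' : η ≤ 2 * R) (hs1 : s ≤ 1) (hαs : α ≤ s / 4)
    (hδs : δ * (1 + s) ≤ α * s / 2) (hbig : 4096 ≤ R ^ (α * s / 2)) :
    4096 * η * R ^ α ≤ (R ^ (-δ) * min (η * R ^ α) R) ^ (1 + s) := by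
  have hR0 : 0 < R := by linarith
  rcases le_total (η * R ^ α) R with h | h
  · rw [min_eq_left h]
    have e : R ^ (-δ) * (η * R ^ α) = η * R ^ (α - δ) := by
      rw [sub_eq_neg_add, Real.rpow_add hR0]; ring
    rw [e, Real.mul_rpow (by positivity) (by positivity), ← Real.rpow_mul hR0.le]
    calc 4096 * η * R ^ α ≤ R ^ (α * s / 2) * η * R ^ α := by gcongr
      _ = η ^ (1 : ℝ) * R ^ (α * s / 2 + α) := by
          rw [Real.rpow_add hR0, Real.rpow_one]; ring
      _ ≤ η ^ (1 + s) * R ^ ((α - δ) * (1 + s)) := by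
          gcongr ?_ * ?_
          · exact Real.rpow_le_rpow_of_exponent_le hη (by linarith)
          · exact Real.rpow_le_rpow_of_exponent_le hR.le (by nlinarith)
  · rw [min_eq_right h]
    have e : R ^ (-δ) * R = R ^ (1 - δ) := by
      rw [sub_eq_neg_add, Real.rpow_add hR0, Real.rpow_one]
    rw [e, ← Real.rpow_mul hR0.le]
    calc 4096 * η * R ^ α ≤ 4096 * (2 * R) * R ^ α := by gcongr
      _ ≤ R ^ (α * s / 2) * (R ^ (α * s / 2) * R) * R ^ α := by
          gcongr
          linarith
      _ = R ^ (α * s / 2 + (α * s / 2 + 1) + α) := by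
          rw [Real.rpow_add hR0, Real.rpow_add hR0, Real.rpow_add hR0, Real.rpow_one]
      _ ≤ R ^ ((1 - δ) * (1 + s)) := by
          refine Real.rpow_le_rpow_of_exponent_le hR.le ?_
          nlinarith [mul_le_mul_of_nonneg_right hs1 hα.le]

theorem one_le_spread {R α δ η : ℝ} (hR : 1 < R) (hη : 1 ≤ η) (hδα : δ ≤ α) (hα1 : α ≤ 1) :
    1 ≤ R ^ (-δ) * min (η * R ^ α) R := by
  have hR0 : 0 < R := by linarith
  have h1 : R ^ δ ≤ min (η * R ^ α) R := by
    refine le_min ?_ ?_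
    · calc R ^ δ ≤ R ^ α := Real.rpow_le_rpow_of_exponent_le hR.le hδα
        _ ≤ η * R ^ α := le_mul_of_one_le_left (by positivity) hη
    · calc R ^ δ ≤ R ^ (1 : ℝ) := Real.rpow_le_rpow_of_exponent_le hR.le (hδα.trans hα1)
        _ = R := Real.rpow_one R
  calc (1 : ℝ) = R ^ (-δ) * R ^ δ := by rw [← Real.rpow_add hR0]; simp
    _ ≤ _ := by gcongr

/-- Bounds on the coefficients of a line of height at most `h` whose `B` is comparable to `B₀`. -/
theorem RLine.coeff_le (hi : 0 < i) (hj : 0 < j) {L : RLine} {h B₀ : ℝ} (hB₀ : 0 < B₀)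
    (hH : L.height i j ≤ h) (hB : B₀ / 2 ≤ L.B) :
    |(L.A : ℝ)| ≤ (2 * h / B₀) ^ i ∧ (L.B : ℝ) ≤ (2 * h / B₀) ^ j := by
  have h1 := L.one_le_B
  have hW := L.one_le_maxAB i hj
  have hWle : L.maxAB i j ≤ 2 * h / B₀ := by
    rw [le_div_iff₀ hB₀]
    unfold RLine.height at hH
    nlinarith
  have key : ∀ {x s : ℝ}, 0 ≤ x → 0 < s → x ^ (1 / s) ≤ L.maxAB i j → x ≤ (2 * h / B₀) ^ s := by
    intro x s hx hs hle
    calc x = (x ^ (1 / s)) ^ s := by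
          rw [← Real.rpow_mul hx, one_div_mul_cancel hs.ne', Real.rpow_one]
      _ ≤ _ := Real.rpow_le_rpow (by positivity) (hle.trans hWle) hs.le
  refine ⟨key (abs_nonneg _) hi (le_max_left _ _), ?_⟩
  rw [← abs_of_nonneg (by linarith : (0 : ℝ) ≤ L.B)]
  exact key (abs_nonneg _) hj (le_max_right _ _)

theorem rpow_div_mul_self (hij : i + j = 1) {x b : ℝ} (hx : 0 ≤ x) (hb : 0 < b) :
    (x / b) ^ i * b = x ^ i * b ^ j := by
  have e : b = b ^ i * b ^ j := by rw [← Real.rpow_add hb, hij, Real.rpow_one]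
  rw [Real.div_rpow hx hb.le, div_mul_eq_mul_div, div_eq_iff (by positivity)]
  nth_rewrite 1 [e]
  ring

theorem two_rpow_mul_two_rpow (hij : i + j = 1) : (2 : ℝ) ^ i * 2 ^ j = 2 := by
  rw [← Real.rpow_add two_pos, hij, Real.rpow_one]

/-- If `b` is at most `2 (2 h / b) ^ j`, then the coefficients of lines at height `h` lie in
a box of area `O(u)` with `u = h ^ (1 / (1 + j))`. -/
theorem box_le_of_height (hi : 0 < i) (hj : 0 < j) (hij : i + j = 1) {h b u : ℝ} (hu : 0 < u)
    (huh : u ^ (1 + j) = h) (hb : 0 < b) (hbh : b ≤ 2 * (2 * h / b) ^ j) :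
    b ≤ 2 * u ^ j ∧ (2 * h / b) ^ i * b ≤ 2 * u := by
  have hh0 : 0 < h := by rw [← huh]; positivity
  have hB : b ≤ 2 * u ^ j := by
    have e3 : (2 * u ^ j) ^ (1 + j) = 2 * 2 ^ j * h ^ j := by
      rw [Real.mul_rpow two_pos.le (by positivity), ← Real.rpow_mul hu.le,
        mul_comm j (1 + j), Real.rpow_mul hu.le, huh, Real.rpow_add two_pos, Real.rpow_one]
    have e2 : b ^ (1 + j) ≤ (2 * u ^ j) ^ (1 + j) := by
      calc b ^ (1 + j) = b * b ^ j := by rw [Real.rpow_add hb, Real.rpow_one]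
        _ ≤ 2 * (2 * h / b) ^ j * b ^ j := by gcongr
        _ = 2 * (2 * h) ^ j := by
            rw [Real.div_rpow (by positivity) hb.le]
            field_simp
        _ = (2 * u ^ j) ^ (1 + j) := by
            rw [e3, Real.mul_rpow two_pos.le hh0.le]
            ring
    exact (Real.rpow_le_rpow_iff hb.le (by positivity) (by linarith)).1 e2
  refine ⟨hB, ?_⟩
  have e4 : (2 * h) ^ i = 2 ^ i * u ^ ((1 + j) * i) := by
    rw [Real.mul_rpow two_pos.le hh0.le, ← huh, ← Real.rpow_mul hu.le]
  have e5 : (2 * u ^ j) ^ j = 2 ^ j * u ^ (j * j) := by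
    rw [Real.mul_rpow two_pos.le (by positivity), ← Real.rpow_mul hu.le]
  calc (2 * h / b) ^ i * b = (2 * h) ^ i * b ^ j := rpow_div_mul_self hij (by positivity) hb
    _ ≤ (2 * h) ^ i * (2 * u ^ j) ^ j := by gcongr
    _ = (2 ^ i * 2 ^ j) * (u ^ ((1 + j) * i) * u ^ (j * j)) := by
        rw [e4, e5]
        ring
    _ = 2 * u := by
        rw [two_rpow_mul_two_rpow hij, ← Real.rpow_add hu]
        have : (1 + j) * i + j * j = 1 := by
          have : i = 1 - j := by linarith
          rw [this]; ring
        rw [this, Real.rpow_one]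

/-- The box containing the coefficients of the lines with `B` below
`R ^ (N j / (1 + j) - 3 l / j)`. -/
theorem box_le_of_B_le (hi : 0 < i) (hj : 0 < j) (hij : i + j = 1) {R N l h b : ℝ} (hR : 1 < R)
    (hl : 0 ≤ l) (hh : 0 ≤ h) (hhR : h ≤ 2 * R ^ N) (hb : 0 < b)
    (hbR : b ≤ 2 * R ^ (N * j / (1 + j) - 3 * l / j)) :
    b ≤ 2 * (R ^ (N / (1 + j) - 3 * l)) ^ j ∧
      (2 * h / b) ^ i * b ≤ 4 * R ^ (N / (1 + j) - 3 * l) := by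
  have hR0 : 0 < R := by linarith
  constructor
  · refine hbR.trans (mul_le_mul_of_nonneg_left ?_ two_pos.le)
    rw [← Real.rpow_mul hR0.le]
    refine Real.rpow_le_rpow_of_exponent_le hR.le ?_
    have : 3 * l * j ≤ 3 * l / j := by
      rw [le_div_iff₀ hj]
      have hj2 : j * j ≤ 1 := by nlinarith
      nlinarith
    have e : (N / (1 + j) - 3 * l) * j = N * j / (1 + j) - 3 * l * j := by ring
    rw [e]; linarith
  have e1 : (2 * (2 * R ^ N)) ^ i = 2 ^ i * 2 ^ i * R ^ (N * i) := by
    rw [Real.mul_rpow two_pos.le (by positivity), Real.mul_rpow two_pos.le (by positivity),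
      ← Real.rpow_mul hR0.le, mul_assoc]
  have e2 : (2 * R ^ (N * j / (1 + j) - 3 * l / j)) ^ j =
      2 ^ j * R ^ ((N * j / (1 + j) - 3 * l / j) * j) := by
    rw [Real.mul_rpow two_pos.le (by positivity), ← Real.rpow_mul hR0.le]
  calc (2 * h / b) ^ i * b = (2 * h) ^ i * b ^ j := rpow_div_mul_self hij (by positivity) hb
    _ ≤ (2 * (2 * R ^ N)) ^ i * (2 * R ^ (N * j / (1 + j) - 3 * l / j)) ^ j := by gcongr
    _ = 2 ^ i * (2 ^ i * 2 ^ j) * (R ^ (N * i) * R ^ ((N * j / (1 + j) - 3 * l / j) * j)) := by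
        rw [e1, e2]
        ring
    _ = 2 ^ i * 2 * R ^ (N / (1 + j) - 3 * l) := by
        rw [two_rpow_mul_two_rpow hij, ← Real.rpow_add hR0]
        congr 2
        have : i = 1 - j := by linarith
        have hj' : 1 + j ≠ 0 := by linarith
        rw [this]
        field_simp
        ring
    _ ≤ 2 ^ (1 : ℝ) * 2 * R ^ (N / (1 + j) - 3 * l) := by
        gcongr ?_ * 2 * _
        exact Real.rpow_le_rpow_of_exponent_le (by norm_num) (by linarith)
    _ = 4 * R ^ (N / (1 + j) - 3 * l) := by rw [Real.rpow_one]; ring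

/-- Lines of height about `h = η R ^ (N - 1)` with `B` about `B₀` whose `Δ` meet a set `S` that
avoids `Δ(L₀)` for all lines `L₀` of height less than `R ^ (N - l - 1)` are nearly uniformly spread.
For `l ≥ 1` the crossing point of any two such lines violates the avoidance property without
further help, so that all traces coincide; for `l = 0` the spreading factor is needed. -/
theorem spread_of_height {θ c : ℝ} (hi : 0 < i) (hj : 0 < j) (hij : i + j = 1) {cθ : ℝ}
    (hθ : BadConst i θ cθ) {R α c₁ N l η B₀ : ℝ} (hR : 1 < R) (hα : 0 < α)
    (hαij : α ≤ i * j / 4) (hc₁ : 0 < c₁) (hc₁' : c₁ ≤ 1 / 1000)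
    (hc : c = c₁ / R ^ (1 + α)) (hcθ : c ≤ cθ) (hN : 0 ≤ N) (hl : l = 0 ∨ 1 ≤ l)
    (hRi : 4096 ≤ R ^ (α * i / 2)) (hRj : 4096 ≤ R ^ (α * j / 2))
    {S : Set ℝ} (havoid : ∀ L : RLine, L.height i j < R ^ (N - l - 1) →
      ∀ y ∈ S, y ∉ Delta i j θ c L)
    (hη : 1 ≤ η) (hη' : η ≤ 2 * R) (hB₀ : 0 < B₀)
    {𝓛 : Set RLine} (hHl : ∀ L ∈ 𝓛, R ^ (N - 1) ≤ L.height i j)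
    (hHu : ∀ L ∈ 𝓛, L.height i j ≤ η * R ^ (N - 1))
    (hBl : ∀ L ∈ 𝓛, B₀ / 2 ≤ L.B) (hBu : ∀ L ∈ 𝓛, (L.B : ℝ) ≤ B₀)
    (hBm : ∀ L ∈ 𝓛, (L.B : ℝ) ≤ R ^ (-(3 / j * l)) * R ^ (N * j / (j + 1)))
    (hS : ∀ L ∈ 𝓛, ∃ y ∈ S, y ∈ Delta i j θ c L)
    (hclose : ∀ L ∈ 𝓛, ∀ L' ∈ 𝓛, |L.yAt θ - L'.yAt θ| ≤ 2 * c₁ * R ^ (l - N)) :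
    ∀ L₁ ∈ 𝓛, ∀ L₂ ∈ 𝓛, L₁.yAt θ ≠ L₂.yAt θ → ∀ L₃ ∈ 𝓛, ∀ L₄ ∈ 𝓛,
      |L₃.yAt θ - L₄.yAt θ| ≤
        R ^ (-(α * (i * j) / 2)) * min (η * R ^ α) R * |L₁.yAt θ - L₂.yAt θ| := by
  intro L₁ h₁
  have hR0 : 0 < R := by linarith
  have hi1 : i < 1 := by linarith
  have hj1 : j < 1 := by linarith
  have hij0 : 0 < i * j := mul_pos hi hj
  have hiji : i * j ≤ i := by nlinarith
  have hijj : i * j ≤ j := by nlinarith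
  have hl0 : 0 ≤ l := by rcases hl with h | h <;> linarith
  set h := η * R ^ (N - 1) with hh
  have hh0 : 0 < h := by positivity
  set X := (2 * h / B₀) ^ i with hX
  have hA : ∀ L ∈ 𝓛, |(L.A : ℝ)| ≤ X := fun L hL =>
    (RLine.coeff_le hi hj hB₀ (hHu L hL) (hBl L hL)).1
  have hh2 : h ≤ 2 * R ^ N := by
    calc h ≤ 2 * R * R ^ (N - 1) := by rw [hh]; gcongr
      _ = 2 * R ^ N := by
          rw [Real.rpow_sub hR0, Real.rpow_one]; field_simp
  have hpar : ∀ L ∈ 𝓛, ∀ L' ∈ 𝓛, L.B * L'.B * |L.yAt θ - L'.yAt θ| < 1 := by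
    intro L hL L' hL'
    have h1 := L.one_le_B
    have h2 := L'.one_le_B
    calc L.B * L'.B * |L.yAt θ - L'.yAt θ|
        ≤ (R ^ (-(3 / j * l)) * R ^ (N * j / (j + 1))) *
          (R ^ (-(3 / j * l)) * R ^ (N * j / (j + 1))) * (2 * c₁ * R ^ (l - N)) := by
          refine mul_le_mul (mul_le_mul (hBm L hL) (hBm L' hL') (by linarith) (by positivity))
            (hclose L hL L' hL') (abs_nonneg _) (by positivity)
      _ = 2 * c₁ * R ^ (-(3 / j * l) + N * j / (j + 1) + (-(3 / j * l) + N * j / (j + 1)) +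
          (l - N)) := by
          rw [← Real.rpow_add hR0, ← Real.rpow_add hR0, mul_comm, mul_assoc, ← Real.rpow_add hR0]
          congr 2
          ring
      _ ≤ 2 * c₁ * R ^ (0 : ℝ) := by
          refine mul_le_mul_of_nonneg_left (Real.rpow_le_rpow_of_exponent_le hR.le ?_)
            (by positivity)
          have e1 : 1 ≤ 3 / j := by rw [le_div_iff₀ hj]; linarith
          have e2 : l ≤ 3 / j * l := le_mul_of_one_le_left hl0 e1
          have e3 : N * j / (j + 1) ≤ N / 2 := by
            rw [div_le_div_iff₀ (by linarith) two_pos]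
            nlinarith
          linarith
      _ < 1 := by rw [Real.rpow_zero]; linarith
  set δ := α * (i * j) / 2 with hδ
  have hαi : α ≤ i / 4 := by linarith
  have hαj : α ≤ j / 4 := by linarith
  have hT1 : 1 ≤ R ^ (-δ) * min (η * R ^ α) R :=
    one_le_spread hR hη (by rw [hδ]; nlinarith) (by linarith)
  have hB2 : B₀ ≤ 2 * L₁.B := by linarith [hBl L₁ h₁]
  rcases hl with rfl | hl
  · -- For `l = 0` the lines are concurrent, so that the gaps can be compared with each other.
    set u := h ^ (1 / (1 + j)) with hu
    have hu0 : 0 < u := by positivity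
    have huh : u ^ (1 + j) = h := by
      rw [hu, ← Real.rpow_mul hh0.le, one_div_mul_cancel (by linarith), Real.rpow_one]
    obtain ⟨hB, hXB⟩ := box_le_of_height hi hj hij hu0 huh hB₀ (hB2.trans
      (mul_le_mul_of_nonneg_left (RLine.coeff_le hi hj hB₀ (hHu L₁ h₁) (hBl L₁ h₁)).2 two_pos.le))
    change X * B₀ ≤ 2 * u at hXB
    have hgain : 4096 * u ^ (1 + j) * R ^ (α + 0 - N + 1) = 4096 * η * R ^ α := by
      rw [huh, hh, ← mul_assoc, mul_assoc (4096 * η), ← Real.rpow_add hR0]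
      congr 2
      ring
    refine spread_of_comparable hi hj hij hθ hR hα hc₁ hc hcθ le_rfl havoid hu0 (by linarith) hB₀
      (hXB.trans (by linarith)) hB ?_ ?_ hA hBl hBu hHl hS hclose hpar (Or.inr ?_) L₁ h₁
    · rw [hgain]
      exact mul_le_spread_rpow hR hα hη hη' hi1.le hαi (by
        rw [hδ]; nlinarith [mul_nonneg hα.le hi.le, mul_nonneg (mul_nonneg hα.le hi.le) hi.le]) hRi
    · rw [hgain]
      exact mul_le_spread_rpow hR hα hη hη' hj1.le hαj (by
        rw [hδ]; nlinarith [mul_nonneg hα.le hj.le, mul_nonneg (mul_nonneg hα.le hj.le) hj.le]) hRj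
    · have e1 : X * B₀ ^ 2 ≤ 4 * h := by
        calc X * B₀ ^ 2 = (X * B₀) * B₀ := by ring
          _ ≤ 2 * u * (2 * u ^ j) := by gcongr
          _ = 4 * h := by rw [← huh, Real.rpow_add hu0, Real.rpow_one]; ring
      have e2 : X * B₀ ^ 2 ≤ 4 * (2 * R ^ N) := by linarith
      calc 3 * (X * B₀ ^ 2 * (2 * c₁ * R ^ (0 - N)))
          ≤ 3 * (4 * (2 * R ^ N) * (2 * c₁ * R ^ (0 - N))) := by gcongr
        _ = 48 * c₁ * (R ^ N * R ^ (0 - N)) := by ring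
        _ < 1 := by
            rw [← Real.rpow_add hR0, add_sub_cancel, Real.rpow_zero]
            linarith
  · -- For `l ≥ 1` the bound on `B` is so small that the comparison works already with `T = 1`.
    intro L₂ h₂ hne L₃ h₃ L₄ h₄
    set u := R ^ (N / (1 + j) - 3 * l) with hu
    have hu0 : 0 < u := by positivity
    have hBle : B₀ ≤ 2 * R ^ (N * j / (1 + j) - 3 * l / j) := by
      refine hB2.trans (mul_le_mul_of_nonneg_left ((hBm L₁ h₁).trans_eq ?_) two_pos.le)
      rw [← Real.rpow_add hR0, add_comm j 1]
      congr 1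
      ring
    obtain ⟨hB, hXB⟩ := box_le_of_B_le hi hj hij hR hl0 hh0.le hh2 hB₀ hBle
    change B₀ ≤ 2 * u ^ j at hB
    change X * B₀ ≤ 4 * u at hXB
    have hgain : 4096 * u ^ (1 + j) * R ^ (α + l - N + 1) ≤ 1 := by
      rw [hu, ← Real.rpow_mul hR0.le, mul_assoc, ← Real.rpow_add hR0]
      calc 4096 * R ^ ((N / (1 + j) - 3 * l) * (1 + j) + (α + l - N + 1))
          ≤ R ^ (α * i / 2) * R ^ ((N / (1 + j) - 3 * l) * (1 + j) + (α + l - N + 1)) := by gcongr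
        _ ≤ 1 := by
            rw [← Real.rpow_add hR0]
            refine Real.rpow_le_one_of_one_le_of_nonpos hR.le ?_
            have hj' : 1 + j ≠ 0 := by linarith
            have e : (N / (1 + j) - 3 * l) * (1 + j) = N - 3 * l * (1 + j) := by
              field_simp
            rw [e]
            nlinarith [mul_nonneg hl0 hj.le, mul_le_mul_of_nonneg_left hi1.le hα.le]
    have hsp := spread_of_comparable hi hj hij hθ hR hα hc₁ hc hcθ hl0 havoid hu0 one_pos hB₀
      hXB hB (by rwa [Real.one_rpow]) (by rwa [Real.one_rpow]) hA hBl hBu hHl hS hclose hpar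
      (Or.inl rfl) L₁ h₁ L₂ h₂ hne L₃ h₃ L₄ h₄
    exact hsp.trans (mul_le_mul_of_nonneg_right hT1 (abs_nonneg _))

end Spread

/-! ### The construction -/

section Construction

variable {i j β θ cθ : ℝ} {R : ℕ} {μ : Measure (ℝ × ℝ)} {root : Set CInterval}
  {child : ℕ → CInterval → Set CInterval}

theorem cOne_pos (hcθ : 0 < cθ) (hR : 0 < (R : ℝ)) : 0 < cOne i j β cθ R := by
  unfold cOne
  exact lt_min (by positivity) (by positivity)

theorem cRem_le (hR : 0 < (R : ℝ)) : cRem i j β cθ R ≤ cθ := by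
  unfold cRem
  rw [div_le_iff₀ (by positivity)]
  exact min_le_left _ _

theorem levelRadius_succ (hR : 0 < (R : ℝ)) (n : ℕ) :
    levelRadius i j β cθ R (n + 1) = levelRadius i j β cθ R n * (R : ℝ)⁻¹ := by
  have e : (R : ℝ) ^ (-((n + 1 : ℕ) : ℝ)) = (R : ℝ) ^ (-(n : ℝ)) * (R : ℝ)⁻¹ := by
    rw [← Real.rpow_neg_one, ← Real.rpow_add hR]
    push_cast
    congr 1
    ring
  unfold levelRadius
  rw [e, mul_assoc, mul_assoc, mul_assoc]

theorem levelRadius_pos (hcθ : 0 < cθ) (hR : 0 < (R : ℝ)) (n : ℕ) :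
    0 < levelRadius i j β cθ R n := by
  have := cOne_pos (i := i) (j := j) (β := β) hcθ hR
  unfold levelRadius
  positivity

theorem spec_of_mem_colI (h : AdmissibleChoice i j β θ cθ R μ root child) :
    ∀ n, ∀ I ∈ colI root child n,
      (θ, I.center) ∈ μ.support ∧ I.radius = levelRadius i j β cθ R n := by
  intro n I hI
  cases n with
  | zero => exact h.1.1 hI
  | succ n =>
    obtain ⟨I', hI', hI⟩ := mem_iUnion₂.1 hI
    have := (h.2 n I' hI').1 hI
    exact ⟨this.1, this.2.2⟩

/-- A child is contained in its parent, because its radius `R⁻¹ ρ` is at most the width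
`R ^ (-α) ρ` of the margin left by the shrunken parent. -/
theorem pts_subset_of_mem_child (h : AdmissibleChoice i j β θ cθ R μ root child) (hcθ : 0 < cθ)
    (hR : 1 ≤ (R : ℝ)) (hα : alpha i j β ≤ 1) {n : ℕ} {I' I : CInterval}
    (hI' : I' ∈ colI root child n) (hI : I ∈ child n I') : I.pts ⊆ I'.pts := by
  obtain ⟨-, h2, h3⟩ := (h.2 n I' hI').1 hI
  have hr' := (spec_of_mem_colI h n I' hI').2
  have hr := levelRadius_pos (i := i) (j := j) (β := β) hcθ (by linarith : 0 < (R : ℝ)) n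
  refine Metric.closedBall_subset_closedBall' ?_
  have h2' : dist I.center I'.center ≤ (1 - (R : ℝ) ^ (-alpha i j β)) * I'.radius := h2
  have h4 : (R : ℝ)⁻¹ ≤ (R : ℝ) ^ (-alpha i j β) := by
    rw [← Real.rpow_neg_one]
    exact Real.rpow_le_rpow_of_exponent_le hR (by linarith)
  rw [h3, levelRadius_succ (by linarith)]
  rw [hr'] at h2' ⊢
  nlinarith

theorem disjoint_of_mem_colI (h : AdmissibleChoice i j β θ cθ R μ root child) (hcθ : 0 < cθ)
    (hR : 1 ≤ (R : ℝ)) (hα : alpha i j β ≤ 1) :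
    ∀ n, ∀ I ∈ colI root child n, ∀ I' ∈ colI root child n, I ≠ I' → Disjoint I.pts I'.pts := by
  intro n
  induction n with
  | zero => exact h.1.2.1
  | succ n ih =>
    intro I hI I' hI' hne
    obtain ⟨K, hK, hIK⟩ := mem_iUnion₂.1 hI
    obtain ⟨K', hK', hIK'⟩ := mem_iUnion₂.1 hI'
    by_cases hKK : K = K'
    · subst hKK
      exact (h.2 n K hK).2.1 I hIK I' hIK' hne
    · exact (ih K hK K' hK' hKK).mono (pts_subset_of_mem_child h hcθ hR hα hK hIK)
        (pts_subset_of_mem_child h hcθ hR hα hK' hIK')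

theorem colJ_subset_colI (m : ℕ) :
    colJ i j β θ cθ R root child m ⊆ colI root child m := by
  induction m with
  | zero => exact subset_rfl
  | succ m ih =>
    intro I hI
    obtain ⟨J, hJ, hIJ⟩ := mem_iUnion₂.1 hI.1
    exact mem_iUnion₂.2 ⟨J, ih hJ, hIJ⟩

/-- The intervals of `𝓙ₘ` avoid `Δ(L)` for the lines of all earlier classes `C(k)`, `k < m`. -/
theorem colJ_avoids (h : AdmissibleChoice i j β θ cθ R μ root child) (hcθ : 0 < cθ)
    (hR : 1 ≤ (R : ℝ)) (hα : alpha i j β ≤ 1) :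
    ∀ m, ∀ J ∈ colJ i j β θ cθ R root child m, ∀ k < m, ∀ L ∈ linesC i j R k,
      ∀ y ∈ J.pts, y ∉ Delta i j θ (cRem i j β cθ R) L := by
  intro m
  induction m with
  | zero => intro _ _ k hk; omega
  | succ m ih =>
    intro J hJ k hk L hL y hy hyL
    rcases Nat.lt_succ_iff_lt_or_eq.1 hk with hk | rfl
    · obtain ⟨K, hK, hJK⟩ := mem_iUnion₂.1 hJ.1
      exact ih K hK k hk L hL y
        (pts_subset_of_mem_child h hcθ hR hα (colJ_subset_colI m hK) hJK hy) hyL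
    · have h1 : y ∈ Delta i j θ (cRem i j β cθ R) L ∩ J.pts := ⟨hyL, hy⟩
      rw [hJ.2 L hL] at h1
      exact h1

theorem colJ_avoids_of_height_lt (h : AdmissibleChoice i j β θ cθ R μ root child) (hcθ : 0 < cθ)
    (hR : 1 < (R : ℝ)) (hα : alpha i j β ≤ 1) (hj : 0 < j) {m : ℕ} {J : CInterval}
    (hJ : J ∈ colJ i j β θ cθ R root child m) {L : RLine}
    (hL : L.height i j < (R : ℝ) ^ ((m : ℝ) - 1)) :
    ∀ y ∈ J.pts, y ∉ Delta i j θ (cRem i j β cθ R) L := by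
  obtain ⟨k, hk, hk'⟩ := exists_nat_pow_near (L.one_le_height i hj) hR
  rw [← Real.rpow_natCast] at hk hk'
  have hkm : k + 1 < m := by
    have h1 := (Real.rpow_lt_rpow_left_iff hR).1 (hk.trans_lt hL)
    have h2 : ((k + 1 : ℕ) : ℝ) < m := by push_cast; linarith
    exact_mod_cast h2
  refine colJ_avoids h hcθ hR.le hα m J hJ (k + 1) hkm L ⟨?_, hk'⟩
  push_cast
  rwa [add_sub_cancel_right]

theorem two_mul_lt_of_disjoint {x x' r : ℝ}
    (h : Disjoint (Metric.closedBall x r) (Metric.closedBall x' r)) : 2 * r < |x - x'| := by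
  by_contra! hle
  have h1 : (x + x') / 2 ∈ Metric.closedBall x r := by
    rw [Metric.mem_closedBall, Real.dist_eq]
    have : (x + x') / 2 - x = -((x - x') / 2) := by ring
    rw [this, abs_neg, abs_div, abs_two]
    linarith
  have h2 : (x + x') / 2 ∈ Metric.closedBall x' r := by
    rw [Metric.mem_closedBall, Real.dist_eq]
    have : (x + x') / 2 - x' = (x - x') / 2 := by ring
    rw [this, abs_div, abs_two]
    linarith
  exact disjoint_left.1 h h1 h2

/-- The spreading factor times the ratio of half-widths `(r + w) / r`, where `r` is the radius of an
interval and `w` the half-width of `Δ(L)`. The two parts of the ratio are matched by the two terms of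
the minimum. -/
theorem spread_mul_ratio_le {R α δ η a : ℝ} (hR : 0 < R) (ha : 0 < a) (hη : 0 < η) :
    R ^ (-δ) * min (η * R ^ α) R * ((a / (2 * R) + 2 * a / (η * R ^ α)) / (a / (2 * R))) ≤
      5 * R ^ (1 - δ) := by
  have e : R ^ (1 - δ) = R ^ (-δ) * R := by
    rw [sub_eq_neg_add, Real.rpow_add hR, Real.rpow_one]
  have hα : 0 < R ^ α := by positivity
  have hδ : 0 < R ^ (-δ) := by positivity
  have hratio : (a / (2 * R) + 2 * a / (η * R ^ α)) / (a / (2 * R)) =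
      1 + 4 * R / (η * R ^ α) := by
    field_simp
    ring
  have h1 : min (η * R ^ α) R * (1 + 4 * R / (η * R ^ α)) ≤ 5 * R := by
    have h2 : min (η * R ^ α) R * (4 * R / (η * R ^ α)) ≤ 4 * R := by
      rw [mul_div_assoc', div_le_iff₀ (by positivity), mul_comm]
      exact mul_le_mul_of_nonneg_left (min_le_left _ _) (by positivity)
    have h3 := min_le_right (η * R ^ α) R
    linarith
  rw [hratio, e, mul_assoc]
  calc _ ≤ R ^ (-δ) * (5 * R) := mul_le_mul_of_nonneg_left h1 hδ.le
    _ = _ := by ring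

/-- The number of intervals of level `n + 1` in `J` that meet `Δ(L)` for a line `L` in a dyadic
subclass of `C(n, l)`, with the height of `L` about `η R ^ (n - 1)` and `B` about `B₀`. -/
theorem card_dyadic_class_le (hi : 0 < i) (hj : 0 < j) (hij : i + j = 1)
    (hθ : BadConst i θ cθ) {b₁ b₂ : ℝ} (hμ : PowerLaw μ β b₁ b₂) (hβ : β ≤ 1) (hR : 1 < (R : ℝ))
    (hRi : 4096 ≤ (R : ℝ) ^ (alpha i j β * i / 2)) (hRj : 4096 ≤ (R : ℝ) ^ (alpha i j β * j / 2))
    (hc₁ : cOne i j β cθ R ≤ 1 / 1000)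
    (h : AdmissibleChoice i j β θ cθ R μ root child) {n l : ℕ} (hln : l ≤ n)
    {J : CInterval} (hJ : J ∈ colJ i j β θ cθ R root child (n - l)) {η B₀ : ℝ}
    (hη : 2 ≤ η) (hη' : η ≤ 2 * R) (hB₀ : 0 < B₀) (F : Finset CInterval) (Λ : CInterval → RLine)
    (hF : ∀ I ∈ F, I ∈ colI root child (n + 1)) (hFJ : ∀ I ∈ F, I.pts ⊆ J.pts)
    (hΛ : ∀ I ∈ F, Λ I ∈ linesCl i j R n l)
    (hΔ : ∀ I ∈ F, (I.pts ∩ Delta i j θ (cRem i j β cθ R) (Λ I)).Nonempty)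
    (hHl : ∀ I ∈ F, η / 2 * (R : ℝ) ^ ((n : ℝ) - 1) ≤ (Λ I).height i j)
    (hHu : ∀ I ∈ F, (Λ I).height i j ≤ η * (R : ℝ) ^ ((n : ℝ) - 1))
    (hBl : ∀ I ∈ F, B₀ / 2 ≤ (Λ I).B) (hBu : ∀ I ∈ F, ((Λ I).B : ℝ) ≤ B₀) :
    (F.card : ℝ) ≤
      (b₂ / b₁) ^ 2 * (120 * (R : ℝ) ^ (1 - alpha i j β * (i * j) / 2)) ^ β := by
  have hβ0 := hμ.1
  have hR0 : 0 < (R : ℝ) := by linarith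
  set α := alpha i j β with hα
  have hij0 : 0 < i * j := mul_pos hi hj
  have hij1 : i * j ≤ 1 := by nlinarith
  have hα0 : 0 < α := by rw [hα]; unfold alpha; positivity
  have hαij : α ≤ i * j / 4 := by rw [hα]; unfold alpha; nlinarith
  have hα1 : α ≤ 1 := by linarith
  set c₁ := cOne i j β cθ R with hc₁d
  have hc₁0 : 0 < c₁ := cOne_pos hθ.1 hR0
  set c := cRem i j β cθ R with hcd
  have hc : c = c₁ / (R : ℝ) ^ (1 + α) := rfl
  have hc0 : 0 < c := by rw [hc]; positivity
  set δ := α * (i * j) / 2 with hδ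
  set T := (R : ℝ) ^ (-δ) * min (η * (R : ℝ) ^ α) R with hT
  have hT1 : 1 ≤ T := one_le_spread hR (by linarith) (by rw [hδ]; nlinarith) hα1
  set g := (R : ℝ) ^ (-(n : ℝ)) with hg
  have hg0 : 0 < g := by positivity
  have hg1 : g ≤ 1 := Real.rpow_le_one_of_one_le_of_nonpos hR.le (by simp)
  set r := levelRadius i j β cθ R (n + 1) with hr
  have hreq : r = c₁ * g / (2 * R) := by
    rw [hr, levelRadius_succ hR0]
    unfold levelRadius
    field_simp
    rfl
  have hr0 : 0 < r := levelRadius_pos hθ.1 hR0 _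
  have hRα : 4096 ≤ (R : ℝ) ^ α := hRi.trans
    (Real.rpow_le_rpow_of_exponent_le hR.le (by nlinarith))
  have hpow : (R : ℝ) ^ (1 + α) * (R : ℝ) ^ ((n : ℝ) - 1) = (R : ℝ) ^ α * g⁻¹ := by
    rw [hg, ← Real.rpow_neg hR0.le, ← Real.rpow_add hR0, ← Real.rpow_add hR0]
    congr 1
    ring
  -- The half-width of the sets `Δ(L)` under consideration.
  set w := 2 * (c₁ * g) / (η * (R : ℝ) ^ α) with hw
  have hw0 : 0 < w := by positivity
  have hcw : c / (η / 2 * (R : ℝ) ^ ((n : ℝ) - 1)) = w := by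
    rw [hc, div_div, mul_left_comm, hpow, hw]
    field_simp
  have hwle : w ≤ c₁ * g / 4096 := by
    rw [hw, div_le_div_iff₀ (by positivity) (by norm_num)]
    have : 2 * 4096 ≤ η * (R : ℝ) ^ α := mul_le_mul hη hRα (by norm_num) (by linarith)
    have h2 : 0 < c₁ * g := by positivity
    nlinarith
  have hrle : r ≤ c₁ * g / 2 := by
    rw [hreq, div_le_div_iff₀ (by positivity) two_pos]
    have h2 : 0 < c₁ * g := by positivity
    nlinarith
  have hc₁g : c₁ * g ≤ 1 / 1000 := (mul_le_of_le_one_right hc₁0.le hg1).trans hc₁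
  have hmargin : ∀ I ∈ F, ∃ y ∈ I.pts, y ∈ Delta i j θ c (Λ I) ∧ |(Λ I).yAt θ - y| ≤ w := by
    intro I hI
    obtain ⟨y, hyI, hyL⟩ := hΔ I hI
    refine ⟨y, hyI, hyL, (abs_yAt_sub_le hj hyL).trans ?_⟩
    rw [← hcw]
    have := hHl I hI
    gcongr
  have hJr : J.radius = 1 / 2 * c₁ * (R : ℝ) ^ ((l : ℝ) - n) := by
    rw [(spec_of_mem_colI h _ J (colJ_subset_colI _ hJ)).2]
    unfold levelRadius
    rw [Nat.cast_sub hln]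
    congr 2
    ring
  have hgl : g ≤ (R : ℝ) ^ ((l : ℝ) - n) :=
    Real.rpow_le_rpow_of_exponent_le hR.le (by
      have : (0 : ℝ) ≤ l := by positivity
      linarith)
  have hclose : ∀ I ∈ F, ∀ I' ∈ F,
      |(Λ I).yAt θ - (Λ I').yAt θ| ≤ 2 * c₁ * (R : ℝ) ^ ((l : ℝ) - n) := by
    intro I hI I' hI'
    obtain ⟨y, hy, -, hyw⟩ := hmargin I hI
    obtain ⟨y', hy', -, hyw'⟩ := hmargin I' hI'
    have h1 : |y - J.center| ≤ J.radius := hFJ I hI hy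
    have h2 : |y' - J.center| ≤ J.radius := hFJ I' hI' hy'
    rw [hJr] at h1 h2
    have h3 : c₁ * g ≤ c₁ * (R : ℝ) ^ ((l : ℝ) - n) := by gcongr
    rw [abs_le] at h1 h2 hyw hyw' ⊢
    constructor <;> linarith
  have hlcases : (l : ℝ) = 0 ∨ 1 ≤ (l : ℝ) := by
    rcases Nat.eq_zero_or_pos l with hl | hl
    · left; exact_mod_cast hl
    · right; exact_mod_cast hl
  have hsp := spread_of_height (𝓛 := Λ '' F) (S := J.pts) (N := n) (l := l) hi hj hij hθ hR hα0
    hαij hc₁0 hc₁ hc (cRem_le hR0) (by positivity) hlcases hRi hRj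
    (fun L hL => colJ_avoids_of_height_lt h hθ.1 hR hα1 hj hJ (by rwa [Nat.cast_sub hln]))
    (by linarith : 1 ≤ η) hη' hB₀ (forall_mem_image.2 fun I hI => (hΛ I hI).1.1)
    (forall_mem_image.2 hHu) (forall_mem_image.2 hBl) (forall_mem_image.2 hBu)
    (forall_mem_image.2 fun I hI => (hΛ I hI).2.2.le)
    (forall_mem_image.2 fun I hI => by
      obtain ⟨y, hy, hyL, -⟩ := hmargin I hI
      exact ⟨y, hFJ I hI hy, hyL⟩)
    (forall_mem_image.2 fun I hI => forall_mem_image.2 fun I' hI' => hclose I hI I' hI')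
  have hW1 : (R : ℝ) ^ ((l : ℝ) - n) ≤ 1 := Real.rpow_le_one_of_one_le_of_nonpos hR.le (by
    have : (l : ℝ) ≤ n := by exact_mod_cast hln
    linarith)
  have hsmall : 2 * (2 * c₁ * (R : ℝ) ^ ((l : ℝ) - n)) + 4 * (r + w) < 1 := by
    have : c₁ * (R : ℝ) ^ ((l : ℝ) - n) ≤ 1 / 1000 :=
      (mul_le_of_le_one_right hc₁0.le hW1).trans hc₁
    linarith
  have hrad : ∀ I ∈ F, I.radius = r := fun I hI => (spec_of_mem_colI h _ I (hF I hI)).2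
  have hsep : ∀ I ∈ F, ∀ I' ∈ F, I ≠ I' → 2 * r < |I.center - I'.center| := by
    intro I hI I' hI' hne
    have hd := disjoint_of_mem_colI h hθ.1 hR.le hα1 _ I (hF I hI) I' (hF I' hI') hne
    unfold CInterval.pts at hd
    rw [hrad I hI, hrad I' hI'] at hd
    exact two_mul_lt_of_disjoint hd
  have hnear : ∀ I ∈ F, |I.center - (Λ I).yAt θ| ≤ r + w := by
    intro I hI
    obtain ⟨y, hy, -, hyw⟩ := hmargin I hI
    have h1 : |y - I.center| ≤ I.radius := hy
    rw [hrad I hI] at h1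
    rw [abs_le] at h1 hyw ⊢
    constructor <;> linarith
  have hcard := hμ.card_le_of_spread (θ := θ) F CInterval.center (fun I => (Λ I).yAt θ)
    hr0 (by linarith) hT1 hsmall (fun I hI => (spec_of_mem_colI h _ I (hF I hI)).1) hsep hnear
    hclose
    (fun I hI I' hI' hne K hK K' hK' => hsp _ (mem_image_of_mem _ hI) _ (mem_image_of_mem _ hI')
      hne _ (mem_image_of_mem _ hK) _ (mem_image_of_mem _ hK'))
  refine hcard.trans ?_
  have hTρ : T * ((r + w) / r) ≤ 5 * (R : ℝ) ^ (1 - δ) := by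
    rw [hreq]
    exact spread_mul_ratio_le hR0 (by positivity) (by linarith)
  have hnn : 0 ≤ T * ((r + w) / r) := by positivity
  have hexp : 24 * (T * ((r + w) / r)) ≤ 120 * (R : ℝ) ^ (1 - δ) := by linarith
  exact mul_le_mul_of_nonneg_left (Real.rpow_le_rpow (by positivity) hexp hβ0.le) (by positivity)

end Construction

/-! ### Summation over the dyadic classes -/

/-- Dyadic localization of a real number at least one. -/
theorem two_pow_floor_logb {x : ℝ} (hx : 1 ≤ x) :
    (2 : ℝ) ^ ⌊Real.logb 2 x⌋₊ ≤ x ∧ x ≤ 2 ^ (⌊Real.logb 2 x⌋₊ + 1) := by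
  have hx0 : 0 < x := by linarith
  have hnn : 0 ≤ Real.logb 2 x := Real.logb_nonneg one_lt_two hx
  constructor
  · rw [← Real.rpow_natCast, ← Real.le_logb_iff_rpow_le one_lt_two hx0]
    exact Nat.floor_le hnn
  · rw [← Real.rpow_natCast, ← Real.logb_le_iff_le_rpow one_lt_two hx0]
    push_cast
    exact (Nat.lt_floor_add_one _).le

/-- The number of dyadic classes times the bound for one class is at most `R ^ (β - ε)`. -/
theorem classes_mul_bound_le {i j β b₁ b₂ : ℝ} {R : ℝ} (hi : 0 < i) (hj : 0 < j)
    (hij : i + j = 1) (hβ0 : 0 < β) (hβ : β ≤ 1) (hR : 1 < R)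
    (hinv : 1 / eps i j β ≤ R ^ eps i j β) (hlog : Real.logb 2 R ≤ R ^ eps i j β)
    (hb : 64 * b₂ ^ 2 / b₁ ^ 2 ≤ R ^ (2 * eps i j β)) :
    ((⌊Real.logb 2 R⌋₊ + 1 : ℕ) : ℝ) * ((⌊lam j * Real.logb 2 R⌋₊ + 1 : ℕ) : ℝ) *
      ((b₂ / b₁) ^ 2 * (120 * R ^ (1 - alpha i j β * (i * j) / 2)) ^ β) ≤
        R ^ (β - eps i j β) := by
  have hR0 : 0 < R := by linarith
  set ε := eps i j β with hε
  have hεeq : ε = β ^ 3 * (i * j) ^ 2 / 80 := by rw [hε]; unfold eps alpha; ring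
  have hij0 : 0 < i * j := mul_pos hi hj
  have hijj : i * j ≤ j := by nlinarith
  have hij1 : i * j ≤ 1 := by nlinarith
  have hβ3 : β ^ 3 ≤ 1 := pow_le_one₀ hβ0.le hβ
  have hε0 : 0 < ε := by rw [hεeq]; positivity
  have hεj : ε ≤ j / 80 := by
    rw [hεeq]
    have h1 : β ^ 3 * (i * j) ^ 2 ≤ 1 * (i * j) ^ 2 := by gcongr
    nlinarith
  have hlog0 : 0 ≤ Real.logb 2 R := Real.logb_nonneg one_lt_two hR.le
  set E := R ^ ε with hE
  have hlam : lam j + 1 ≤ E := by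
    refine le_trans ?_ hinv
    unfold lam
    calc 3 / j + 1 ≤ 80 / j := by
          have : 1 ≤ 1 / j := by rw [le_div_iff₀ hj]; linarith
          have e3 : 3 / j = 3 * (1 / j) := by ring
          have e80 : 80 / j = 80 * (1 / j) := by ring
          rw [e3, e80]
          linarith
      _ ≤ 1 / ε := by
          rw [div_le_div_iff₀ hj hε0]
          linarith
  have hlam0 : 0 < lam j := by unfold lam; positivity
  have hE80 : 80 ≤ E := by
    refine le_trans ?_ hinv
    rw [le_div_iff₀ hε0]
    linarith
  have k1 : ((⌊Real.logb 2 R⌋₊ + 1 : ℕ) : ℝ) ≤ 2 * E := by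
    push_cast
    have := Nat.floor_le hlog0
    linarith
  have k2 : ((⌊lam j * Real.logb 2 R⌋₊ + 1 : ℕ) : ℝ) ≤ E ^ 2 := by
    push_cast
    have h1 := Nat.floor_le (mul_nonneg hlam0.le hlog0)
    have h2 : lam j * Real.logb 2 R ≤ lam j * E := by gcongr
    nlinarith
  have hE2 : R ^ (2 * ε) = E ^ 2 := by
    rw [hE, mul_comm, Real.rpow_mul hR0.le, ← Real.rpow_natCast]
    norm_num
  have k3 : (b₂ / b₁) ^ 2 ≤ E ^ 2 / 64 := by
    rw [hE2, mul_div_assoc, ← div_pow] at hb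
    linarith
  have k4 : (120 * R ^ (1 - alpha i j β * (i * j) / 2)) ^ β ≤ 120 * R ^ (β - 10 * ε) := by
    rw [Real.mul_rpow (by norm_num) (by positivity), ← Real.rpow_mul hR0.le]
    gcongr ?_ * ?_
    · calc (120 : ℝ) ^ β ≤ 120 ^ (1 : ℝ) :=
            Real.rpow_le_rpow_of_exponent_le (by norm_num) hβ
        _ = 120 := Real.rpow_one _
    · refine Real.rpow_le_rpow_of_exponent_le hR.le ?_
      have e1 : (1 - alpha i j β * (i * j) / 2) * β = β - β ^ 2 * (i * j) ^ 2 / 8 := by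
        unfold alpha; ring
      rw [e1, hεeq]
      have : β ^ 3 * (i * j) ^ 2 ≤ β ^ 2 * (i * j) ^ 2 := by
        have : β ^ 3 ≤ β ^ 2 := pow_le_pow_of_le_one hβ0.le hβ (by norm_num)
        gcongr
      linarith
  have k5 : R ^ (β - ε) = E ^ 9 * R ^ (β - 10 * ε) := by
    rw [hE, ← Real.rpow_natCast, ← Real.rpow_mul hR0.le, ← Real.rpow_add hR0]
    congr 1
    push_cast
    ring
  rw [k5]
  have hP : 0 < R ^ (β - 10 * ε) := by positivity
  have hE0 : 0 < E := by linarith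
  calc _ ≤ 2 * E * E ^ 2 * (E ^ 2 / 64 * (120 * R ^ (β - 10 * ε))) := by
        gcongr
    _ = 15 / 4 * (E ^ 5 * R ^ (β - 10 * ε)) := by ring
    _ ≤ E ^ 4 * (E ^ 5 * R ^ (β - 10 * ε)) := by
        gcongr
        calc (15 / 4 : ℝ) ≤ 80 ^ 4 := by norm_num
          _ ≤ E ^ 4 := by gcongr
    _ = _ := by ring

theorem finite_and_ncard_le {α : Type*} {s : Set α} {M : ℝ}
    (h : ∀ F : Finset α, (F : Set α) ⊆ s → (F.card : ℝ) ≤ M) :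
    s.Finite ∧ (s.ncard : ℝ) ≤ M := by
  have hfin : s.Finite := by
    by_contra hinf
    obtain ⟨F, hF, hcard⟩ := Set.Infinite.exists_subset_card_eq hinf (⌊M⌋₊ + 1)
    have := h F hF
    rw [hcard] at this
    push_cast at this
    exact absurd this (not_le.2 (Nat.lt_floor_add_one M))
  refine ⟨hfin, ?_⟩
  rw [Set.ncard_eq_toFinset_card s hfin]
  exact h _ (by simp)

end VerticalCantor

theorem theorem8 (i j : ℝ) (hi : 0 < i) (hj : 0 < j) (hij : i + j = 1)
    (θ cθ : ℝ) (hθ : VerticalCantor.BadConst i θ cθ)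
    (μ : MeasureTheory.Measure (ℝ × ℝ)) [MeasureTheory.IsProbabilityMeasure μ]
    (hμΘ : μ.support ⊆ VerticalCantor.Theta θ)
    (β b₁ b₂ : ℝ) (hμ : VerticalCantor.PowerLaw μ β b₁ b₂)
    (R : ℕ) (hR : VerticalCantor.ROne i j β b₁ b₂ ≤ (R : ℝ))
    (root : Set VerticalCantor.CInterval)
    (child : ℕ → VerticalCantor.CInterval → Set VerticalCantor.CInterval)
    (hchoice : VerticalCantor.AdmissibleChoice i j β θ cθ R μ root child)
    (n l : ℕ) (hl : (l : ℝ) ≤ (n : ℝ) * j / (VerticalCantor.lam j * (j + 1)))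
    (J : VerticalCantor.CInterval)
    (hJ : J ∈ VerticalCantor.colJ i j β θ cθ R root child (n - l)) :
    (VerticalCantor.removed i j β θ cθ R root child n l J).Finite ∧
      ((VerticalCantor.removed i j β θ cθ R root child n l J).ncard : ℝ) ≤
        (R : ℝ) ^ (β - VerticalCantor.eps i j β) := by
  open VerticalCantor in
  classical
  obtain ⟨hβ0, hb₁, hb₂, -⟩ := id hμ
  have hβ : β ≤ 1 := hμ.exponent_le_one hμΘ
  have hi1 : i < 1 := by linarith
  have hj1 : j < 1 := by linarith
  have hij0 : 0 < i * j := mul_pos hi hj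
  have hiji : i * j ≤ i := by nlinarith
  have hijj : i * j ≤ j := by nlinarith
  have hβ2 : β ^ 2 ≤ 1 := pow_le_one₀ hβ0.le hβ
  set α := alpha i j β with hα
  set ε := eps i j β with hε
  have hα0 : 0 < α := by rw [hα]; unfold alpha; positivity
  have hαij : α ≤ i * j / 4 := by rw [hα]; unfold alpha; nlinarith
  have hεeq : ε = α * (β ^ 2 * (i * j)) / 20 := by rw [hε]; unfold eps; ring
  have hε0 : 0 < ε := by rw [hεeq]; positivity
  have hεα : ε ≤ α * (i * j) / 20 := by
    rw [hεeq]
    have : β ^ 2 * (i * j) ≤ 1 * (i * j) := by gcongr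
    nlinarith
  have hα4 : α ≤ 1 / 4 := by linarith
  have hε80 : ε ≤ 1 / 80 := by nlinarith
  obtain ⟨hR1, hinv, hlog⟩ := bounds_of_RZero_le hε0 (by linarith)
    ((le_max_left _ _).trans hR)
  have hR0 : 0 < (R : ℝ) := by linarith
  have hb : 64 * b₂ ^ 2 / b₁ ^ 2 ≤ (R : ℝ) ^ (2 * ε) := by
    have h1 : (64 * b₂ ^ 2 / b₁ ^ 2) ^ (10 / (alpha i j β * β ^ 2 * i * j)) ≤ (R : ℝ) :=
      ((le_max_left _ _).trans (le_max_right _ _)).trans hR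
    have h2 : 10 / (alpha i j β * β ^ 2 * i * j) * (2 * ε) = 1 := by
      rw [hεeq, ← hα]
      field_simp
      norm_num
    calc 64 * b₂ ^ 2 / b₁ ^ 2
        = ((64 * b₂ ^ 2 / b₁ ^ 2) ^ (10 / (alpha i j β * β ^ 2 * i * j))) ^ (2 * ε) := by
          rw [← Real.rpow_mul (by positivity), h2, Real.rpow_one]
      _ ≤ _ := Real.rpow_le_rpow (by positivity) h1 (by positivity)
  have hbig : ∀ s : ℝ, 2 * ε ≤ s → 4096 ≤ (R : ℝ) ^ s := by
    intro s hs
    have h80 : 80 ≤ (R : ℝ) ^ ε := by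
      refine le_trans ?_ hinv
      rw [le_div_iff₀ hε0]
      linarith
    calc (4096 : ℝ) ≤ 80 * 80 := by norm_num
      _ ≤ (R : ℝ) ^ ε * (R : ℝ) ^ ε := by gcongr
      _ = (R : ℝ) ^ (2 * ε) := by rw [← Real.rpow_add hR0, two_mul]
      _ ≤ (R : ℝ) ^ s := Real.rpow_le_rpow_of_exponent_le hR1.le hs
  have hc₁ : cOne i j β cθ R ≤ 1 / 1000 := by
    refine (min_le_right _ _).trans ?_
    have h1 : 2 * ε ≤ 3 * i / j := by
      rw [le_div_iff₀ hj]
      nlinarith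
    have h2 := hbig _ h1
    rw [Real.rpow_neg hR0.le, ← div_eq_mul_inv, div_le_div_iff₀ (by positivity) (by norm_num)]
    linarith
  have hεi : 2 * ε ≤ α * i / 2 := by
    have : α * (i * j) ≤ α * i := by gcongr
    linarith
  have hεj : 2 * ε ≤ α * j / 2 := by
    have : α * (i * j) ≤ α * j := by gcongr
    linarith
  have hln : l ≤ n := by
    have h1 : (n : ℝ) * j / (lam j * (j + 1)) ≤ n := by
      have hden : 1 ≤ lam j * (j + 1) := by
        have : 1 ≤ lam j := by unfold lam; rw [le_div_iff₀ hj]; linarith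
        nlinarith
      rw [div_le_iff₀ (by linarith)]
      have hn : (0 : ℝ) ≤ n := by positivity
      nlinarith
    exact_mod_cast hl.trans h1
  refine finite_and_ncard_le fun F hF => ?_
  have hex : ∀ I ∈ F, ∃ L ∈ linesCl i j R n l,
      (I.pts ∩ Delta i j θ (cRem i j β cθ R) L).Nonempty := fun I hI => (hF hI).2.2
  have : Nonempty RLine := ⟨⟨0, 1, 0, by simp, one_pos⟩⟩
  choose! Λ hΛ hΔ using hex
  set hmin := (R : ℝ) ^ ((n : ℝ) - 1) with hhmin
  set bmin := (R : ℝ) ^ (-(lam j * ((l : ℝ) + 1))) * (R : ℝ) ^ ((n : ℝ) * j / (j + 1)) with hbmin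
  have hhmin0 : 0 < hmin := by positivity
  have hbmin0 : 0 < bmin := by positivity
  have hH1 : ∀ I ∈ F, 1 ≤ (Λ I).height i j / hmin := fun I hI => by
    rw [one_le_div hhmin0]; exact (hΛ I hI).1.1
  have hH2 : ∀ I ∈ F, (Λ I).height i j / hmin ≤ R := fun I hI => by
    rw [div_le_iff₀ hhmin0, hhmin, Real.rpow_sub hR0, Real.rpow_one, mul_div_cancel₀ _ hR0.ne']
    exact (hΛ I hI).1.2.le
  have hB1 : ∀ I ∈ F, 1 ≤ ((Λ I).B : ℝ) / bmin := fun I hI => by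
    rw [one_le_div hbmin0]; exact (hΛ I hI).2.1
  have hB2 : ∀ I ∈ F, ((Λ I).B : ℝ) / bmin ≤ (R : ℝ) ^ lam j := fun I hI => by
    rw [div_le_iff₀ hbmin0, hbmin, ← mul_assoc, ← Real.rpow_add hR0]
    refine (hΛ I hI).2.2.le.trans_eq ?_
    congr 2
    ring
  set κ : CInterval → ℕ × ℕ := fun I =>
    (⌊Real.logb 2 ((Λ I).height i j / hmin)⌋₊, ⌊Real.logb 2 (((Λ I).B : ℝ) / bmin)⌋₊) with hκ
  set K := Finset.range (⌊Real.logb 2 R⌋₊ + 1) ×ˢ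
    Finset.range (⌊lam j * Real.logb 2 R⌋₊ + 1) with hK
  have hmaps : (F : Set CInterval).MapsTo κ K := by
    intro I hI
    simp only [hK, hκ, Finset.coe_product, Set.mem_prod, Finset.mem_coe, Finset.mem_range,
      Nat.lt_succ_iff]
    constructor
    · apply Nat.floor_le_floor
      exact Real.logb_le_logb_of_le one_lt_two (by linarith [hH1 I hI]) (hH2 I hI)
    · apply Nat.floor_le_floor
      rw [← Real.logb_rpow_eq_mul_logb_of_pos hR0]
      exact Real.logb_le_logb_of_le one_lt_two (by linarith [hB1 I hI]) (hB2 I hI)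
  set M := (b₂ / b₁) ^ 2 * (120 * (R : ℝ) ^ (1 - alpha i j β * (i * j) / 2)) ^ β with hM
  have hclass : ∀ k ∈ K, (({I ∈ F | κ I = k} : Finset CInterval).card : ℝ) ≤ M := by
    rintro ⟨k, m⟩ -
    rcases ({I ∈ F | κ I = (k, m)} : Finset CInterval).eq_empty_or_nonempty with he | ⟨I₀, hI₀⟩
    · rw [he, Finset.card_empty, Nat.cast_zero]
      positivity
    have hk : ∀ I ∈ ({I ∈ F | κ I = (k, m)} : Finset CInterval), I ∈ F ∧
        (2 ^ k ≤ (Λ I).height i j / hmin ∧ (Λ I).height i j / hmin ≤ 2 ^ (k + 1)) ∧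
        (2 ^ m ≤ ((Λ I).B : ℝ) / bmin ∧ ((Λ I).B : ℝ) / bmin ≤ 2 ^ (m + 1)) := by
      intro I hI
      obtain ⟨hIF, hIk⟩ := Finset.mem_filter.1 hI
      obtain ⟨rfl, rfl⟩ := Prod.mk.inj hIk
      exact ⟨hIF, two_pow_floor_logb (hH1 I hIF), two_pow_floor_logb (hB1 I hIF)⟩
    refine card_dyadic_class_le (η := 2 ^ (k + 1)) (B₀ := 2 ^ (m + 1) * bmin) hi hj hij hθ hμ hβ
      hR1 (hbig _ hεi) (hbig _ hεj) hc₁ hchoice hln hJ ?_ ?_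
      (by positivity) _ Λ (fun I hI => (hF (hk I hI).1).1) (fun I hI => (hF (hk I hI).1).2.1)
      (fun I hI => hΛ I (hk I hI).1) (fun I hI => hΔ I (hk I hI).1) ?_ ?_ ?_ ?_
    · rw [pow_succ]
      have : (1 : ℝ) ≤ 2 ^ k := one_le_pow₀ one_le_two
      linarith
    · rw [pow_succ]
      have := (hk I₀ hI₀).2.1.1.trans (hH2 I₀ (hk I₀ hI₀).1)
      linarith
    · intro I hI
      have := (hk I hI).2.1.1
      rw [le_div_iff₀ hhmin0] at this
      rw [pow_succ, mul_div_cancel_right₀ _ two_ne_zero]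
      exact this
    · intro I hI
      have := (hk I hI).2.1.2
      rwa [div_le_iff₀ hhmin0] at this
    · intro I hI
      have := (hk I hI).2.2.1
      rw [le_div_iff₀ hbmin0] at this
      rw [pow_succ]
      linarith
    · intro I hI
      have := (hk I hI).2.2.2
      rwa [div_le_iff₀ hbmin0] at this
  calc (F.card : ℝ) = ∑ k ∈ K, (({I ∈ F | κ I = k} : Finset CInterval).card : ℝ) := by
        rw [Finset.card_eq_sum_card_fiberwise hmaps]
        push_cast
        rfl
    _ ≤ ∑ _k ∈ K, M := Finset.sum_le_sum hclass
    _ = ((⌊Real.logb 2 R⌋₊ + 1 : ℕ) : ℝ) * ((⌊lam j * Real.logb 2 R⌋₊ + 1 : ℕ) : ℝ) * M := by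
        rw [Finset.sum_const, nsmul_eq_mul, hK, Finset.card_product, Finset.card_range,
          Finset.card_range, Nat.cast_mul]
    _ ≤ (R : ℝ) ^ (β - ε) := classes_mul_bound_le hi hj hij hβ0 hβ hR1 hinv hlog hb
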